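/- Let $L^2=L^2(0,1)$ and let $H^1_{per}$ be the space of all $u\in L^2$ that have a weak derivative $u_x\in L^2$ in the $1$-periodic sense, i.e. $\int_0^1 u\varphi_x\,dx=-\int_0^1 u_x\varphi\,dx$ for every smooth $1$-periodic $\varphi$ (equivalently $u\in H^1(0,1)$ and $u(0)=u(1)$), with the norm $(\|u\|_{L^2}^2+\|u_x\|_{L^2}^2)^{1/2}$; let $(H^1_{per})'$ be its dual, in which $L^2$ is embedded by $v\mapsto (v,\cdot)_{L^2}$. Let $\dot H^1$ be the space of the $u\in H^1_{per}$ with $\int_0^1u\,dx=0$, with the norm $\|u\|_{\dot H^1}=\|u_x\|_{L^2}$. Let $a\in C([0,\infty);\dot H^1)$ satisfy $\|a(\tau)\|_{\dot H^1}\le M$ for every $\tau\ge 0$, with some constant $M$, and let the distributional time derivative $a_\tau$ belong to $L^2_{loc}(0,\infty;L^2)$. Let $y_0\in L^\infty(0,1)$, and let $y$ be a weak solution of $$y_\tau-y_{xx}-a(\tau)y_x=0 \ \text{ in } (0,1)\times(0,\infty),\qquad y(0,\tau)=y(1,\tau),\quad y_x(0,\tau)=y_x(1,\tau),\qquad y(\cdot,0)=y_0,$$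 that is, $y\in L^2_{loc}(0,\infty;H^1_{per})\cap C([0,\infty);L^2)$, the distributional time derivative satisfies $y_\tau\in L^2_{loc}(0,\infty;(H^1_{per})')$, $y(0)=y_0$, and for every $z\in H^1_{per}$ $$\langle y_\tau(\tau),z\rangle_{(H^1_{per})'\times H^1_{per}}+(y_x(\tau),z_x)_{L^2}-(a(\tau)y_x(\tau),z)_{L^2}=0\quad\text{for a.e. }\tau>0.$$ Here $L^2_{loc}(0,\infty;X)$ means square integrability on every compact subinterval of $(0,\infty)$. If $y_0$ is not equal almost everywhere on $(0,1)$ to a constant, then $$\|y(\tau)\|_{L^\infty(0,1)}<\|y_0\|_{L^\infty(0,1)}\qquad\text{for every }\tau>0.$$ -/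

import Mathlib

open Set MeasureTheory
open scoped ContDiff ENNReal

noncomputable section

namespace PeriodicParabolic

/-- Lebesgue measure on the interval `(0,1)`. -/
abbrev unitMeasure : Measure ℝ := volume.restrict (Ioo (0 : ℝ) 1)

/-- The real Hilbert space `L²(0,1)`. -/
abbrev L2 : Type := Lp ℝ 2 unitMeasure

/-- Smooth `1`-periodic functions on the line, the test functions in the space variable. -/
def IsPeriodicTest (φ : ℝ → ℝ) : Prop :=
  ContDiff ℝ ∞ φ ∧ Function.Periodic φ 1

/-- `g` is the weak derivative of `u` in the `1`-periodic sense. Since the test functions are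
periodic and need not vanish at the end points, this encodes both that `u ∈ H¹(0,1)` with
`u_x = g` and that `u(0) = u(1)`. -/
def IsPeriodicWeakDeriv (u g : L2) : Prop :=
  ∀ φ : ℝ → ℝ, IsPeriodicTest φ →
    ∫ x in Ioo (0 : ℝ) 1, u x * deriv φ x = - ∫ x in Ioo (0 : ℝ) 1, g x * φ x

/-- A function that is continuous on the line is square integrable on `(0,1)`. -/
lemma memLp_of_continuous {φ : ℝ → ℝ} (h : Continuous φ) : MemLp φ 2 unitMeasure := by
  obtain ⟨C, hC⟩ := isCompact_Icc.exists_bound_of_continuousOn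
    (s := Icc (0 : ℝ) 1) h.continuousOn
  refine MemLp.of_bound h.aestronglyMeasurable C ?_
  filter_upwards [ae_restrict_mem measurableSet_Ioo] with x hx
  exact hC x (Ioo_subset_Icc_self hx)

lemma integrable_mul_of_continuous (u : L2) {φ : ℝ → ℝ} (h : Continuous φ) :
    Integrable (fun x => u x * φ x) unitMeasure :=
  (Lp.memLp u).integrable_mul (memLp_of_continuous h)

lemma integral_add_mul (u v : L2) {φ : ℝ → ℝ} (h : Continuous φ) :
    ∫ x, (u + v : L2) x * φ x ∂unitMeasure
      = (∫ x, u x * φ x ∂unitMeasure) + ∫ x, v x * φ x ∂unitMeasure := by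
  rw [← integral_add (integrable_mul_of_continuous u h) (integrable_mul_of_continuous v h)]
  refine integral_congr_ae ?_
  filter_upwards [Lp.coeFn_add u v] with x hx
  rw [hx, Pi.add_apply, add_mul]

lemma integral_smul_mul (c : ℝ) (u : L2) (φ : ℝ → ℝ) :
    ∫ x, (c • u : L2) x * φ x ∂unitMeasure = c * ∫ x, u x * φ x ∂unitMeasure := by
  rw [← integral_const_mul]
  refine integral_congr_ae ?_
  filter_upwards [Lp.coeFn_smul c u] with x hx
  rw [hx, Pi.smul_apply, smul_eq_mul, mul_assoc]

lemma integral_zero_mul (φ : ℝ → ℝ) : ∫ x, (0 : L2) x * φ x ∂unitMeasure = 0 := by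
  simpa using integral_smul_mul 0 0 φ

/-- The Sobolev space `H¹_per`, realised as the space of the pairs `(u, u_x)` in `L² × L²`,
with the norm `(‖u‖² + ‖u_x‖²)^(1/2)`. -/
def H1per : Submodule ℝ (WithLp 2 (L2 × L2)) where
  carrier := {p | IsPeriodicWeakDeriv p.fst p.snd}
  add_mem' := by
    intro p q hp hq φ hφ
    have h1 : Continuous φ := hφ.1.continuous
    have h2 : Continuous (deriv φ) := hφ.1.continuous_deriv (by simp)
    have e1 := hp φ hφ
    have e2 := hq φ hφ
    simp only [WithLp.add_fst, WithLp.add_snd]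
    rw [integral_add_mul _ _ h1, integral_add_mul _ _ h2, e1, e2]
    ring
  zero_mem' := by
    intro φ _
    simp only [WithLp.zero_fst, WithLp.zero_snd]
    rw [integral_zero_mul, integral_zero_mul, neg_zero]
  smul_mem' := by
    intro c p hp φ hφ
    have e1 := hp φ hφ
    simp only [WithLp.smul_fst, WithLp.smul_snd]
    rw [integral_smul_mul, integral_smul_mul, e1]
    ring

/-- The embedding `H¹_per → L²`, `u ↦ u`. -/
def H1per.fn : H1per →L[ℝ] L2 :=
  (WithLp.fstL 2 ℝ L2 L2).comp H1per.subtypeL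

/-- The weak derivative `H¹_per → L²`, `u ↦ u_x`. -/
def H1per.dx : H1per →L[ℝ] L2 :=
  (WithLp.sndL 2 ℝ L2 L2).comp H1per.subtypeL

/-- The subspace of the elements of `H¹_per` with zero mean. -/
def zeroMean : Submodule ℝ H1per where
  carrier := {u | ∫ x in Ioo (0 : ℝ) 1, H1per.fn u x = 0}
  add_mem' := by
    intro u v hu hv
    have h := integral_add_mul (H1per.fn u) (H1per.fn v) (φ := fun _ => 1) continuous_const
    simp only [mul_one, mem_ofPred_eq] at h hu hv ⊢
    rw [map_add, h, hu, hv, add_zero]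
  zero_mem' := by
    have h := integral_zero_mul (fun _ => 1)
    simp only [mul_one, mem_ofPred_eq] at h ⊢
    rw [map_zero, h]
  smul_mem' := by
    intro c u hu
    have h := integral_smul_mul c (H1per.fn u) (fun _ => 1)
    simp only [mul_one, mem_ofPred_eq] at h hu ⊢
    rw [map_smul, h, hu, mul_zero]

/-- The space `Ḣ¹` of the elements of `H¹_per` with zero mean. It is a type of its own because its
norm is `‖u‖_{Ḣ¹} = ‖u_x‖_{L²}`, and not the one inherited from `H¹_per`. -/
def Hdot1 : Type := zeroMean

instance : AddCommGroup Hdot1 := inferInstanceAs (AddCommGroup zeroMean)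

instance : Module ℝ Hdot1 := inferInstanceAs (Module ℝ zeroMean)

/-- The inclusion of `Ḣ¹` in `H¹_per`. -/
def Hdot1.toH1per : Hdot1 →ₗ[ℝ] H1per := zeroMean.subtype

/-- An element of `Ḣ¹` as an element of `L²`. -/
def Hdot1.fn : Hdot1 →ₗ[ℝ] L2 := H1per.fn.toLinearMap ∘ₗ Hdot1.toH1per

/-- The weak derivative of an element of `Ḣ¹`. -/
def Hdot1.dx : Hdot1 →ₗ[ℝ] L2 := H1per.dx.toLinearMap ∘ₗ Hdot1.toH1per

/-- The norm `‖u‖_{Ḣ¹} = ‖u_x‖_{L²}`. -/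
instance : SeminormedAddCommGroup Hdot1 :=
  SeminormedAddCommGroup.induced Hdot1 L2 Hdot1.dx

/-- The dual space `(H¹_per)'`. -/
abbrev H1perDual : Type := StrongDual ℝ H1per

/-- The embedding `L² → (H¹_per)'`, `v ↦ (z ↦ (v, z)_{L²})`. -/
def toH1perDual (v : L2) : H1perDual := (innerSL ℝ v).comp H1per.fn

/-- `f ∈ L²_loc(0,∞;X)`: square integrability on compact subintervals of `(0,∞)`. -/
def MemL2loc {X : Type*} [NormedAddCommGroup X] (f : ℝ → X) : Prop :=
  ∀ s T : ℝ, 0 < s → s < T → MemLp f 2 (volume.restrict (Icc s T))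

/-- `g` is the distributional derivative on `(0,∞)` of the vector-valued function `f`. -/
def IsWeakTimeDeriv {X : Type*} [NormedAddCommGroup X] [NormedSpace ℝ X] (f g : ℝ → X) : Prop :=
  ∀ φ : ℝ → ℝ, ContDiff ℝ ∞ φ → HasCompactSupport φ → tsupport φ ⊆ Ioi 0 →
    ∫ τ in Ioi (0 : ℝ), deriv φ τ • f τ = - ∫ τ in Ioi (0 : ℝ), φ τ • g τ

/-- `y` is a weak solution on `(0,∞)` of `y_τ - y_xx - a(τ) y_x = 0` with periodic boundary
conditions and with the initial datum `y₀`: it belongs to `C([0,∞);L²)` and to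
`L²_loc(0,∞;H¹_per)` (as the function `Y`), it has a distributional derivative
`yτ ∈ L²_loc(0,∞;(H¹_per)')`, and for every `z ∈ H¹_per` and almost every `τ > 0`
`⟨y_τ(τ), z⟩ + (y_x(τ), z_x) - (a(τ) y_x(τ), z) = 0`. -/
def IsWeakSolution (a : ℝ → Hdot1) (y₀ : ℝ → ℝ) (y : ℝ → L2) : Prop :=
  ContinuousOn y (Ici 0) ∧
  (∀ᵐ x ∂unitMeasure, y 0 x = y₀ x) ∧
  ∃ (Y : ℝ → H1per) (yτ : ℝ → H1perDual),
    MemL2loc Y ∧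
    (∀ᵐ τ ∂(volume.restrict (Ioi (0 : ℝ))), H1per.fn (Y τ) = y τ) ∧
    MemL2loc yτ ∧
    IsWeakTimeDeriv (fun τ => toH1perDual (y τ)) yτ ∧
    ∀ z : H1per, ∀ᵐ τ ∂(volume.restrict (Ioi (0 : ℝ))),
      yτ τ z
        + (∫ x in Ioo (0 : ℝ) 1, H1per.dx (Y τ) x * H1per.dx z x)
        - (∫ x in Ioo (0 : ℝ) 1, Hdot1.fn (a τ) x * H1per.dx (Y τ) x * H1per.fn z x) = 0

end PeriodicParabolic

end

/-!
The bound `|y| ≤ K := ‖y₀‖_∞` is the weak maximum principle; its strictness comes from a logarithmic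
energy estimate, which in one space dimension replaces a Harnack inequality.

*Energy inequality* (`IsWeakSolution.energy_inequality`). Let `G` be convex, `F = G'`, `f = G''` with
`f` bounded and Lipschitz. Then `F(y)` is an admissible test function and
`d/dt ∫ G(y) ≤ -∫ f(y) y_x² + ∫ a F(y) y_x` in integrated form. Convexity makes a regularisation in
time unnecessary: `G(y(t)) - G(y(t-r)) ≤ F(y(t)) (y(t) - y(t-r))`, and the right-hand side is the
integral of `⟨y_τ(ρ), F(y(t))⟩` over `ρ ∈ [t-r, t]`. Averaging over `t` and letting `r → 0`, by the
continuity of translations in `L²`, gives the claim (`sub_le_integral_of_increments`). The drift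
is controlled by `|a| ≤ ‖a_x‖ ≤ M`, since `a` has mean zero.

*Weak maximum principle* (`IsWeakSolution.le_of_le`). Let `G` vanish exactly on `(-∞, c]`, with `f`
nondecreasing. Then `F² ≤ 2 f G`, so the drift is absorbed by Young's inequality, and Grönwall's
inequality shows that `y(s) ≤ c` implies `y(t) ≤ c` for `t ≥ s`.

*Strictness* (`IsWeakSolution.exists_le_sub`). Let `w = K - y ≥ 0`. As `y₀` is not constant, `∫ w ≥ m`
with some `m > 0` on a short time interval, whose length is denoted by `T`. With
`G(y) = -log (w + ε)` one has `f = F²`, and hence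
`d/dt ∫ G(y) ≤ M²/2 - ½ ‖∂ₓ log (w + ε)‖²`. Since `∫ G(y)` is at most `log (1/ε)` at the beginning
and bounded below at the end, there is a time at which `‖∂ₓ log (w + ε)‖ ≤ ℓ`, where `ℓ²` is of
the order of `log (1/ε) / T`. In one dimension this bounds the oscillation of `log (w + ε)`, and
`w ≥ m` somewhere, so that `w + ε ≥ m exp (-ℓ)` (`le_sub_of_norm_dx_log_le`). The exponent is
of the order of the square root of `log (1/ε)`, so for small `ε` the lower bound is at least `2ε`;
that is, `y ≤ K - ε` at that time, and at all later times by the weak maximum principle. The same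
argument applies to `-y`.
-/

namespace PeriodicParabolic

/-! ### Weak derivatives on an interval -/

/-- Unlike `tsupport φ` itself, the interval obtained here is nonempty even if `φ = 0`. -/
lemma exists_Icc_of_tsupport_subset {α β : ℝ} (hαβ : α < β) {φ : ℝ → ℝ}
    (hc : HasCompactSupport φ) (hs : tsupport φ ⊆ Ioo α β) :
    ∃ p q, α < p ∧ p < q ∧ q < β ∧ ∀ x, x ∉ Icc p q → φ x = 0 := by
  rcases (tsupport φ).eq_empty_or_nonempty with h | h
  · have hφ : φ = 0 := tsupport_eq_empty_iff.1 h
    exact ⟨α + (β - α) / 3, β - (β - α) / 3, by linarith, by linarith, by linarith,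
      fun x _ => by simp [hφ]⟩
  · have hK : IsCompact (tsupport φ) := hc
    have h1 := hs (hK.sInf_mem h)
    have h2 := hs (hK.sSup_mem h)
    refine ⟨(α + sInf (tsupport φ)) / 2, (β + sSup (tsupport φ)) / 2, by linarith [h1.1], ?_,
      by linarith [h2.2], ?_⟩
    · have := csInf_le_csSup h hK.bddBelow hK.bddAbove
      linarith [h1.1, h2.2]
    · intro x hx
      by_contra hne
      have hxs : x ∈ tsupport φ := subset_tsupport _ hne
      have a1 := csInf_le hK.bddBelow hxs
      have a2 := le_csSup hK.bddAbove hxs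
      exact hx ⟨by linarith [h1.1], by linarith [h2.2]⟩

/-- A smooth function whose integral vanishes has a smooth compactly supported primitive. -/
lemma exists_test_primitive {α β : ℝ} (hαβ : α < β) {η : ℝ → ℝ} (hη : ContDiff ℝ ∞ η)
    (hc : HasCompactSupport η) (hs : tsupport η ⊆ Ioo α β) (h0 : ∫ x, η x = 0) :
    ∃ φ : ℝ → ℝ, ContDiff ℝ ∞ φ ∧ HasCompactSupport φ ∧ tsupport φ ⊆ Ioo α β ∧
      deriv φ = η := by
  obtain ⟨p, q, hp, hpq, hq, hz⟩ := exists_Icc_of_tsupport_subset hαβ hc hs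
  have hd : ∀ x, HasDerivAt (fun x => ∫ t in p..x, η t) (η x) x := fun x =>
    (hη.continuous.integral_hasStrictDerivAt p x).hasDerivAt
  have hderiv : deriv (fun x => ∫ t in p..x, η t) = η := funext fun x => (hd x).deriv
  have hzero : ∀ x, x ∉ Icc p q → ∫ t in p..x, η t = 0 := by
    intro x hx
    rcases lt_or_ge x p with h | h
    · rw [intervalIntegral.integral_symm, intervalIntegral.integral_zero_ae, neg_zero]
      refine (Measure.ae_ne volume p).mono fun t htp ht => hz t fun h' => ?_
      rw [uIoc_of_le h.le] at ht
      exact htp (le_antisymm ht.2 h'.1)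
    · have hxq : q < x := by by_contra h'; exact hx ⟨h, not_lt.1 h'⟩
      rw [intervalIntegral.integral_eq_integral_of_support_subset, h0]
      intro t ht
      have hne : η t ≠ 0 := ht
      have htI : t ∈ Icc p q := by by_contra h'; exact hne (hz t h')
      refine ⟨lt_of_le_of_ne htI.1 fun h' => hne ?_, htI.2.trans hxq.le⟩
      -- the integrand vanishes to the left of `p`, hence at `p` by continuity
      have : closure (Iio p) ⊆ {x | η x = 0} :=
        closure_minimal (fun x hx => hz x fun h'' => absurd h''.1 (not_le.2 hx))
          (isClosed_eq hη.continuous continuous_const)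
      rw [closure_Iio] at this
      exact this (h'.ge : t ≤ p)
  refine ⟨fun x => ∫ t in p..x, η t, ?_, ?_, ?_, hderiv⟩
  · rw [contDiff_infty_iff_deriv, hderiv]
    exact ⟨fun x => (hd x).differentiableAt, hη⟩
  · exact HasCompactSupport.intro isCompact_Icc hzero
  · refine (closure_minimal ?_ isClosed_Icc).trans (Icc_subset_Ioo hp hq)
    intro x hx
    by_contra h
    exact hx (hzero x h)

/-- The du Bois-Reymond lemma: a function on an interval whose distributional derivative is zero is
constant. -/
lemma ae_eq_const_of_integral_mul_deriv_eq_zero {α β : ℝ} (hαβ : α < β) {v : ℝ → ℝ}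
    (hv : IntegrableOn v (Ioo α β))
    (h : ∀ φ : ℝ → ℝ, ContDiff ℝ ∞ φ → HasCompactSupport φ → tsupport φ ⊆ Ioo α β →
      ∫ x in Ioo α β, v x * deriv φ x = 0) :
    ∃ c : ℝ, ∀ᵐ x, x ∈ Ioo α β → v x = c := by
  let b : ContDiffBump ((α + β) / 2) :=
    ⟨(β - α) / 8, (β - α) / 4, by linarith, by linarith⟩
  set ρ : ℝ → ℝ := b.normed volume with hρdef
  have hρ : ContDiff ℝ ∞ ρ := b.contDiff_normed
  have hρc : HasCompactSupport ρ := b.hasCompactSupport_normed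
  have hρs : tsupport ρ ⊆ Ioo α β := by
    rw [hρdef, b.tsupport_normed_eq, Real.closedBall_eq_Icc]
    exact Icc_subset_Ioo (by simp only [b]; linarith) (by simp only [b]; linarith)
  have hρ1 : ∫ x, ρ x = 1 := b.integral_normed
  set c := ∫ x in Ioo α β, v x * ρ x with hcdef
  have key : ∀ ψ : ℝ → ℝ, Continuous ψ → HasCompactSupport ψ →
      IntegrableOn (fun x => v x * ψ x) (Ioo α β) := by
    intro ψ h1 h2
    obtain ⟨C, hC⟩ := h2.exists_bound_of_continuous h1
    exact Integrable.mul_bdd hv h1.aestronglyMeasurable (Filter.Eventually.of_forall hC)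
  have hsupp : ∀ ψ : ℝ → ℝ, tsupport ψ ⊆ Ioo α β → ∫ x in Ioo α β, ψ x = ∫ x, ψ x :=
    fun ψ hψ => setIntegral_eq_integral_of_forall_compl_eq_zero fun x hx =>
      by_contra fun hne => hx (hψ (subset_tsupport _ hne))
  refine ⟨c, ?_⟩
  have hint : LocallyIntegrableOn (fun x => v x - c) (Ioo α β) :=
    (hv.sub (integrableOn_const (by simp))).locallyIntegrableOn
  have := isOpen_Ioo.ae_eq_zero_of_integral_contDiff_smul_eq_zero (U := Ioo α β) (μ := volume)
    hint ?_
  · exact this.mono fun x hx hxI => sub_eq_zero.1 (hx hxI)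
  intro ψ hψ hψc hψs
  set m := ∫ x, ψ x
  -- subtracting a multiple of the normalised bump makes `ψ` the derivative of a test function
  have hηs : tsupport (fun x => ψ x - m * ρ x) ⊆ Ioo α β := by
    refine (tsupport_sub _ _).trans (union_subset hψs ?_)
    exact (closure_mono (Function.support_mul_subset_right _ _)).trans hρs
  obtain ⟨φ, h1, h2, h3, h4⟩ := exists_test_primitive hαβ (η := fun x => ψ x - m * ρ x)
    (hψ.sub (contDiff_const.mul hρ)) (hψc.sub hρc.mul_left) hηs (by
      rw [integral_sub (hψ.continuous.integrable_of_hasCompactSupport hψc)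
        ((hρ.continuous.integrable_of_hasCompactSupport hρc).const_mul m),
        integral_const_mul, hρ1]
      simp [m])
  have h5 := h φ h1 h2 h3
  rw [h4] at h5
  have h6 : ∫ x in Ioo α β, (v x * ψ x - m * (v x * ρ x)) = 0 := by
    rw [← h5]; congr 1; ext x; ring
  rw [integral_sub (key ψ hψ.continuous hψc) ((key ρ hρ.continuous hρc).const_mul m),
    integral_const_mul, ← hcdef] at h6
  have h7 : ∫ x, ψ x • (v x - c) = ∫ x in Ioo α β, ψ x • (v x - c) := by
    refine (setIntegral_eq_integral_of_forall_compl_eq_zero fun x hx => ?_).symm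
    rw [by_contra fun hne => hx (hψs (subset_tsupport _ hne)), zero_smul]
  have h8 : ∫ x in Ioo α β, ψ x • (v x - c) = ∫ x in Ioo α β, (v x * ψ x - c * ψ x) := by
    congr 1; ext x; simp only [smul_eq_mul]; ring
  rw [h7, h8, integral_sub (key ψ hψ.continuous hψc)
    ((hψ.continuous.integrable_of_hasCompactSupport hψc).integrableOn.const_mul c),
    integral_const_mul, hsupp ψ hψs]
  linarith

/-- A function on an interval with an integrable distributional derivative is a primitive of that
derivative. -/
lemma ae_eq_const_add_integral_of_weakDeriv {α β : ℝ} (hαβ : α < β) {u g : ℝ → ℝ}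
    (hu : IntegrableOn u (Ioo α β)) (hg : IntegrableOn g (Ioo α β))
    (h : ∀ φ : ℝ → ℝ, ContDiff ℝ ∞ φ → HasCompactSupport φ → tsupport φ ⊆ Ioo α β →
      ∫ x in Ioo α β, u x * deriv φ x = - ∫ x in Ioo α β, g x * φ x) :
    ∃ c : ℝ, ∀ᵐ x, x ∈ Ioo α β → u x = c + ∫ t in α..x, g t := by
  have hgi : IntervalIntegrable g volume α β := by
    rw [intervalIntegrable_iff_integrableOn_Ioo_of_le hαβ.le]; exact hg
  have hAC := hgi.absolutelyContinuousOnInterval_intervalIntegral left_mem_uIcc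
  have hUint : IntegrableOn (fun x => ∫ t in α..x, g t) (Ioo α β) := by
    have := hAC.continuousOn
    rw [uIcc_of_le hαβ.le] at this
    exact (this.integrableOn_compact isCompact_Icc).mono_set Ioo_subset_Icc_self
  obtain ⟨c, hc⟩ := ae_eq_const_of_integral_mul_deriv_eq_zero hαβ
    (v := fun x => u x - ∫ t in α..x, g t) (hu.sub hUint) (by
      intro φ h1 h2 h3
      have hcd : Continuous (deriv φ) := h1.continuous_deriv (by simp)
      have h2' : HasCompactSupport (deriv φ) := h2.deriv
      have hi : ∀ w : ℝ → ℝ, IntegrableOn w (Ioo α β) →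
          IntegrableOn (fun x => w x * deriv φ x) (Ioo α β) := by
        intro w hw
        obtain ⟨C, hC⟩ := h2'.exists_bound_of_continuous hcd
        exact Integrable.mul_bdd hw hcd.aestronglyMeasurable (Filter.Eventually.of_forall hC)
      have hφα : φ α = 0 := by
        by_contra hne; exact (lt_irrefl α) (h3 (subset_tsupport _ hne)).1
      have hφβ : φ β = 0 := by
        by_contra hne; exact (lt_irrefl β) (h3 (subset_tsupport _ hne)).2
      have hφAC : AbsolutelyContinuousOnInterval φ α β :=
        ((h1.of_le (by simp)).contDiffOn).absolutelyContinuousOnInterval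
      have parts := hAC.integral_mul_deriv_eq_deriv_mul hφAC
      rw [hφα, hφβ, mul_zero, mul_zero, sub_zero, zero_sub] at parts
      have e1 : ∫ x in α..β, deriv (fun x => ∫ t in α..x, g t) x * φ x
          = ∫ x in α..β, g x * φ x := by
        refine intervalIntegral.integral_congr_ae ?_
        filter_upwards [hgi.ae_hasDerivAt_integral] with x hx hxI
        rw [(hx (uIoc_subset_uIcc hxI) α left_mem_uIcc).deriv]
      rw [e1, intervalIntegral.integral_of_le hαβ.le, intervalIntegral.integral_of_le hαβ.le,
        integral_Ioc_eq_integral_Ioo, integral_Ioc_eq_integral_Ioo] at parts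
      simp only [sub_mul]
      rw [integral_sub (hi _ hu) (hi _ hUint), h φ h1 h2 h3, parts, sub_self])
  exact ⟨c, hc.mono fun x hx hxI => by linarith [hx hxI]⟩

/-! ### The space `H¹_per` in one dimension -/

/-- The periodic extension of a test function on `(0,1)` is a periodic test function. -/
lemma isPeriodicTest_comp_fract {φ : ℝ → ℝ} (h : ContDiff ℝ ∞ φ) (hc : HasCompactSupport φ)
    (hs : tsupport φ ⊆ Ioo 0 1) : IsPeriodicTest (fun x => φ (Int.fract x)) := by
  refine ⟨contDiff_iff_contDiffAt.2 fun x => ?_, fun x => by simp⟩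
  obtain ⟨p, q, hp, hpq, hq, hz⟩ := exists_Icc_of_tsupport_subset zero_lt_one hc hs
  have h1 := Int.floor_le x
  have h2 := Int.lt_floor_add_one x
  -- around `[n, n + 1)` the extension is `φ (· - n)`, also slightly to the left of `n`
  have hev : (fun y => φ (Int.fract y)) =ᶠ[nhds x] fun y => φ (y - ⌊x⌋) := by
    filter_upwards [Ioo_mem_nhds (a := (⌊x⌋ : ℝ) - (1 - q)) (b := ⌊x⌋ + 1)
      (by linarith) h2] with y hy
    rcases lt_or_ge y ⌊x⌋ with hyn | hyn
    · have hfl : ⌊y⌋ = ⌊x⌋ - 1 := by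
        rw [Int.floor_eq_iff]; push_cast; constructor <;> linarith [hy.1]
      have : Int.fract y = y - ⌊x⌋ + 1 := by
        rw [Int.fract, hfl]; push_cast; ring
      rw [this, hz _ fun h' => by linarith [h'.2, hy.1], hz _ fun h' => by linarith [h'.1]]
    · have hfl : ⌊y⌋ = ⌊x⌋ := by
        rw [Int.floor_eq_iff]; exact ⟨hyn, hy.2⟩
      rw [Int.fract, hfl]
  exact ContDiffAt.congr_of_eventuallyEq
    (h.comp (contDiff_id.sub contDiff_const)).contDiffAt hev

lemma eventuallyEq_comp_fract (φ : ℝ → ℝ) {x : ℝ} (hx : x ∈ Ioo (0 : ℝ) 1) :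
    (fun x => φ (Int.fract x)) =ᶠ[nhds x] φ := by
  filter_upwards [isOpen_Ioo.mem_nhds hx] with y hy
  rw [Int.fract_eq_self.2 ⟨hy.1.le, hy.2⟩]

instance : IsProbabilityMeasure unitMeasure := ⟨by simp⟩

lemma L2.integrable (u : L2) : Integrable u unitMeasure :=
  (Lp.memLp u).integrable (by norm_num)

lemma L2.integral_abs_le_norm (u : L2) : ∫ x, |u x| ∂unitMeasure ≤ ‖u‖ := by
  have h := eLpNorm_le_eLpNorm_of_exponent_le (μ := unitMeasure) (p := 1) (q := 2) (by norm_num)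
    (Lp.memLp u).1
  have h1 := ENNReal.toReal_mono (Lp.memLp u).2.ne h
  rw [← Lp.norm_def] at h1
  refine le_trans (le_of_eq ?_) h1
  rw [eLpNorm_one_eq_lintegral_enorm, ← integral_norm_eq_lintegral_enorm (Lp.memLp u).1]
  simp only [Real.norm_eq_abs]

/-- An element of `H¹_per` has an absolutely continuous representative with equal boundary
values. -/
lemma exists_absolutelyContinuous_rep (u : H1per) :
    ∃ U : ℝ → ℝ, AbsolutelyContinuousOnInterval U 0 1 ∧ U 0 = U 1 ∧
      (∀ᵐ x ∂unitMeasure, H1per.fn u x = U x) ∧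
      (∀ᵐ x ∂unitMeasure, HasDerivAt U (H1per.dx u x) x) ∧
      (∀ x ∈ Icc (0 : ℝ) 1, ∀ y ∈ Icc (0 : ℝ) 1, |U x - U y| ≤ ‖H1per.dx u‖) := by
  have hweak : IsPeriodicWeakDeriv (H1per.fn u) (H1per.dx u) := u.2
  have hg := L2.integrable (H1per.dx u)
  have hgi : IntervalIntegrable (H1per.dx u) volume 0 1 := by
    rw [intervalIntegrable_iff_integrableOn_Ioo_of_le zero_le_one]; exact hg
  obtain ⟨c, hc⟩ := ae_eq_const_add_integral_of_weakDeriv zero_lt_one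
    (L2.integrable (H1per.fn u)) hg (by
      intro φ h1 h2 h3
      have h4 := hweak _ (isPeriodicTest_comp_fract h1 h2 h3)
      have e1 : ∫ x in Ioo (0 : ℝ) 1, H1per.fn u x * deriv (fun x => φ (Int.fract x)) x
          = ∫ x in Ioo (0 : ℝ) 1, H1per.fn u x * deriv φ x :=
        setIntegral_congr_fun measurableSet_Ioo fun x hx => by
          simp only [(eventuallyEq_comp_fract φ hx).deriv_eq]
      have e2 : ∫ x in Ioo (0 : ℝ) 1, H1per.dx u x * φ (Int.fract x)
          = ∫ x in Ioo (0 : ℝ) 1, H1per.dx u x * φ x :=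
        setIntegral_congr_fun measurableSet_Ioo fun x hx => by
          simp only [(eventuallyEq_comp_fract φ hx).eq_of_nhds]
      rw [← e1, h4, e2])
  have hAC := hgi.absolutelyContinuousOnInterval_intervalIntegral left_mem_uIcc
  have h01 : ∫ t in (0 : ℝ)..1, H1per.dx u t = 0 := by
    have := hweak (fun _ => 1) ⟨contDiff_const, fun _ => rfl⟩
    simp only [deriv_const, mul_zero, integral_zero, mul_one] at this
    rw [intervalIntegral.integral_of_le zero_le_one, integral_Ioc_eq_integral_Ioo]
    linarith
  refine ⟨fun x => c + ∫ t in (0 : ℝ)..x, H1per.dx u t, ?_, ?_, ?_, ?_, ?_⟩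
  · have hconst : AbsolutelyContinuousOnInterval (fun _ : ℝ => c) 0 1 :=
      (contDiff_const (n := 1)).contDiffOn.absolutelyContinuousOnInterval
    exact hconst.add hAC
  · simp [h01]
  · rw [ae_restrict_iff' measurableSet_Ioo]
    exact hc
  · rw [ae_restrict_iff' measurableSet_Ioo]
    filter_upwards [hgi.ae_hasDerivAt_integral] with x hx hxI
    exact (hx (by rw [uIcc_of_le zero_le_one]; exact Ioo_subset_Icc_self hxI) 0
      left_mem_uIcc).const_add c
  · have hii : ∀ x ∈ Icc (0 : ℝ) 1, IntervalIntegrable (H1per.dx u) volume 0 x := fun x hx =>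
      hgi.mono_set (by
        rw [uIcc_of_le hx.1, uIcc_of_le zero_le_one]; exact Icc_subset_Icc_right hx.2)
    have habs : ∫ t in (0 : ℝ)..1, |H1per.dx u t| ≤ ‖H1per.dx u‖ := by
      rw [intervalIntegral.integral_of_le zero_le_one, integral_Ioc_eq_integral_Ioo]
      exact L2.integral_abs_le_norm _
    have main : ∀ x ∈ Icc (0 : ℝ) 1, ∀ y ∈ Icc (0 : ℝ) 1, x ≤ y →
        |∫ t in x..y, H1per.dx u t| ≤ ‖H1per.dx u‖ := by
      intro x hx y hy hxy
      refine (intervalIntegral.abs_integral_le_integral_abs hxy).trans (le_trans ?_ habs)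
      exact intervalIntegral.integral_mono_interval hx.1 hxy hy.2
        (Filter.Eventually.of_forall fun t => abs_nonneg _) hgi.abs
    intro x hx y hy
    have e : (c + ∫ t in (0 : ℝ)..x, H1per.dx u t) - (c + ∫ t in (0 : ℝ)..y, H1per.dx u t)
        = ∫ t in y..x, H1per.dx u t := by
      rw [← intervalIntegral.integral_interval_sub_left (hii x hx) (hii y hy)]; ring
    rw [e]
    rcases le_total y x with h | h
    · exact main y hy x hx h
    · rw [intervalIntegral.integral_symm, abs_neg]
      exact main x hx y hy h

/-- An absolutely continuous function with equal boundary values has a periodic weak derivative. -/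
lemma isPeriodicWeakDeriv_of_absolutelyContinuous {u g : L2} {U : ℝ → ℝ}
    (hU : AbsolutelyContinuousOnInterval U 0 1) (h01 : U 0 = U 1)
    (hu : ∀ᵐ x ∂unitMeasure, u x = U x) (hg : ∀ᵐ x ∂unitMeasure, HasDerivAt U (g x) x) :
    IsPeriodicWeakDeriv u g := by
  intro φ hφ
  have hφAC : AbsolutelyContinuousOnInterval φ 0 1 :=
    ((hφ.1.of_le (by simp)).contDiffOn).absolutelyContinuousOnInterval
  have parts := hU.integral_mul_deriv_eq_deriv_mul hφAC
  have hφ01 : φ 1 = φ 0 := by simpa using hφ.2 0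
  rw [hφ01, h01, sub_self, zero_sub, intervalIntegral.integral_of_le zero_le_one,
    intervalIntegral.integral_of_le zero_le_one, integral_Ioc_eq_integral_Ioo,
    integral_Ioc_eq_integral_Ioo] at parts
  have e1 : ∫ x in Ioo (0 : ℝ) 1, u x * deriv φ x = ∫ x in Ioo (0 : ℝ) 1, U x * deriv φ x :=
    integral_congr_ae (hu.mono fun x hx => by simp only [hx])
  have e2 : ∫ x in Ioo (0 : ℝ) 1, g x * φ x = ∫ x in Ioo (0 : ℝ) 1, deriv U x * φ x :=
    integral_congr_ae (hg.mono fun x hx => by simp only [hx.deriv])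
  rw [e1, e2, parts]

/-- In one dimension the oscillation is controlled by the norm of the derivative; here one of the
two points is replaced by the mean. -/
lemma ae_abs_sub_integral_le (u : H1per) :
    ∀ᵐ x ∂unitMeasure, |H1per.fn u x - ∫ y, H1per.fn u y ∂unitMeasure| ≤ ‖H1per.dx u‖ := by
  obtain ⟨U, -, -, hU, -, hosc⟩ := exists_absolutelyContinuous_rep u
  have hi : Integrable U unitMeasure := (L2.integrable (H1per.fn u)).congr hU
  filter_upwards [hU, ae_restrict_mem measurableSet_Ioo] with x hx hxI
  rw [hx, integral_congr_ae hU]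
  have e : U x - ∫ y, U y ∂unitMeasure = ∫ y, (U x - U y) ∂unitMeasure := by
    rw [integral_sub (integrable_const _) hi]; simp
  rw [e, ← Real.norm_eq_abs]
  refine (norm_integral_le_of_norm_le_const (C := ‖H1per.dx u‖) ?_).trans (by simp)
  filter_upwards [ae_restrict_mem measurableSet_Ioo] with y hy
  exact hosc x (Ioo_subset_Icc_self hxI) y (Ioo_subset_Icc_self hy)

lemma ae_abs_fn_le (u : H1per) :
    ∀ᵐ x ∂unitMeasure, |H1per.fn u x| ≤ ‖H1per.fn u‖ + ‖H1per.dx u‖ := by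
  filter_upwards [ae_abs_sub_integral_le u] with x hx
  have h1 : |∫ y, H1per.fn u y ∂unitMeasure| ≤ ‖H1per.fn u‖ :=
    abs_integral_le_integral_abs.trans (L2.integral_abs_le_norm _)
  have h2 := abs_add_le (H1per.fn u x - ∫ y, H1per.fn u y ∂unitMeasure)
    (∫ y, H1per.fn u y ∂unitMeasure)
  rw [sub_add_cancel] at h2
  linarith

lemma Hdot1.ae_abs_fn_le (a : Hdot1) : ∀ᵐ x ∂unitMeasure, |Hdot1.fn a x| ≤ ‖a‖ := by
  have h0 : ∫ x, H1per.fn (Hdot1.toH1per a) x ∂unitMeasure = 0 :=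
    Subtype.property (p := fun u => u ∈ zeroMean) a
  filter_upwards [ae_abs_sub_integral_le (Hdot1.toH1per a)] with x hx
  rw [h0, sub_zero] at hx
  exact hx

/-! ### Superposition operators -/

/-- A convex function `G` with derivative `F` and second derivative `f`, where `f` is bounded
by `B` and Lipschitz continuous with constant `L`. -/
structure ConvexProfile where
  f : ℝ → ℝ
  F : ℝ → ℝ
  G : ℝ → ℝ
  B : NNReal
  L : NNReal
  hasDerivAt_F : ∀ s, HasDerivAt F (f s) s
  hasDerivAt_G : ∀ s, HasDerivAt G (F s) s
  f_nonneg : ∀ s, 0 ≤ f s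
  f_le : ∀ s, f s ≤ B
  lipschitz_f : LipschitzWith L f

namespace ConvexProfile

variable (P : ConvexProfile)

lemma abs_f_le (s : ℝ) : |P.f s| ≤ P.B := by
  rw [abs_of_nonneg (P.f_nonneg s)]; exact P.f_le s

lemma continuous_F : Continuous P.F :=
  continuous_iff_continuousAt.2 fun s => (P.hasDerivAt_F s).continuousAt

lemma continuous_G : Continuous P.G :=
  continuous_iff_continuousAt.2 fun s => (P.hasDerivAt_G s).continuousAt

lemma lipschitz_F : LipschitzWith P.B P.F :=
  lipschitzWith_of_nnnorm_deriv_le (fun s => (P.hasDerivAt_F s).differentiableAt) fun s => by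
    rw [(P.hasDerivAt_F s).deriv, ← NNReal.coe_le_coe, coe_nnnorm]
    exact P.abs_f_le s

lemma abs_F_sub_le (s t : ℝ) : |P.F s - P.F t| ≤ P.B * |s - t| := by
  simpa [Real.dist_eq] using P.lipschitz_F.dist_le_mul s t

lemma abs_f_sub_le (s t : ℝ) : |P.f s - P.f t| ≤ P.L * |s - t| := by
  simpa [Real.dist_eq] using P.lipschitz_f.dist_le_mul s t

lemma monotone_F : Monotone P.F :=
  monotone_of_deriv_nonneg (fun s => (P.hasDerivAt_F s).differentiableAt) fun s => by
    rw [(P.hasDerivAt_F s).deriv]; exact P.f_nonneg s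

lemma G_sub_le (a b : ℝ) : P.G b - P.G a ≤ P.F b * (b - a) := by
  have hcont : ∀ s : Set ℝ, ContinuousOn P.G s := fun s => P.continuous_G.continuousOn
  rcases lt_trichotomy a b with h | h | h
  · obtain ⟨c, hc, hc'⟩ := exists_hasDerivAt_eq_slope P.G P.F h (hcont _)
      fun x _ => P.hasDerivAt_G x
    rw [eq_div_iff (by linarith)] at hc'
    rw [← hc']
    exact mul_le_mul_of_nonneg_right (P.monotone_F hc.2.le) (by linarith)
  · simp [h]
  · obtain ⟨c, hc, hc'⟩ := exists_hasDerivAt_eq_slope P.G P.F h (hcont _)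
      fun x _ => P.hasDerivAt_G x
    rw [eq_div_iff (by linarith)] at hc'
    have := mul_le_mul_of_nonneg_right (P.monotone_F hc.1.le) (by linarith : 0 ≤ a - b)
    linarith

lemma memLp_F_comp (u : L2) : MemLp (fun x => P.F (u x)) 2 unitMeasure := by
  have h1 : MemLp (fun x => |P.F 0| + P.B * |u x|) 2 unitMeasure :=
    MemLp.add (f := fun _ => |P.F 0|) (g := fun x => P.B * |u x|) (memLp_const _)
      ((Lp.memLp u).norm.const_mul (P.B : ℝ))
  refine h1.mono (P.continuous_F.comp_aestronglyMeasurable (Lp.memLp u).1)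
    (Filter.Eventually.of_forall fun x => ?_)
  have h2 := P.abs_F_sub_le (u x) 0
  have h3 := abs_add_le (P.F (u x) - P.F 0) (P.F 0)
  rw [sub_add_cancel] at h3
  rw [sub_zero] at h2
  rw [Real.norm_eq_abs, Real.norm_eq_abs]
  exact le_trans (by linarith) (le_abs_self _)

/-- The superposition operator `u ↦ F(u)` on `L²`. -/
noncomputable def superposition (u : L2) : L2 := (P.memLp_F_comp u).toLp

lemma coeFn_superposition (u : L2) :
    ∀ᵐ x ∂unitMeasure, P.superposition u x = P.F (u x) := (P.memLp_F_comp u).coeFn_toLp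

lemma norm_superposition_sub_le (u v : L2) :
    ‖P.superposition u - P.superposition v‖ ≤ P.B * ‖u - v‖ := by
  refine Lp.norm_le_mul_norm_of_ae_le_mul ?_
  filter_upwards [P.coeFn_superposition u, P.coeFn_superposition v,
    Lp.coeFn_sub (P.superposition u) (P.superposition v), Lp.coeFn_sub u v] with x h1 h2 h3 h4
  rw [h3, h4, Pi.sub_apply, Pi.sub_apply, h1, h2]
  exact P.abs_F_sub_le _ _

lemma lipschitz_superposition : LipschitzWith P.B P.superposition :=
  LipschitzWith.of_dist_le_mul fun u v => by
    rw [dist_eq_norm, dist_eq_norm]; exact P.norm_superposition_sub_le u v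

/-- The convex integral functional `u ↦ ∫ G(u)` on `L²`. -/
noncomputable def energy (u : L2) : ℝ := ∫ x, P.G (u x) ∂unitMeasure

lemma integrable_G_comp (u : L2) : Integrable (fun x => P.G (u x)) unitMeasure := by
  have hm := P.continuous_G.comp_aestronglyMeasurable (Lp.memLp u).1
  refine integrable_of_le_of_le hm (g₁ := fun x => P.G 0 + P.F 0 * u x)
    (g₂ := fun x => P.G 0 + P.F (u x) * u x) ?_ ?_ ?_ ?_
  · refine Filter.Eventually.of_forall fun x => ?_
    have := P.G_sub_le (u x) 0
    simp only
    linarith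
  · refine Filter.Eventually.of_forall fun x => ?_
    have := P.G_sub_le 0 (u x)
    simp only
    rw [sub_zero] at this
    linarith
  · exact (integrable_const _).add ((L2.integrable u).const_mul _)
  · exact (integrable_const _).add ((P.memLp_F_comp u).integrable_mul (Lp.memLp u))

lemma inner_superposition (u v : L2) :
    inner ℝ (P.superposition u) v = ∫ x, P.F (u x) * v x ∂unitMeasure := by
  rw [L2.inner_def]
  refine integral_congr_ae ?_
  filter_upwards [P.coeFn_superposition u] with x hx
  simp [hx, mul_comm]

/-- The subgradient inequality for the convex functional `energy`. -/
lemma energy_sub_le (u v : L2) :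
    P.energy u - P.energy v ≤ inner ℝ (P.superposition u) (u - v) := by
  rw [energy, energy, ← integral_sub (P.integrable_G_comp u) (P.integrable_G_comp v),
    inner_superposition]
  refine integral_mono_ae ((P.integrable_G_comp u).sub (P.integrable_G_comp v))
    ((P.memLp_F_comp u).integrable_mul (Lp.memLp (u - v))) ?_
  filter_upwards [Lp.coeFn_sub u v] with x hx
  rw [hx]
  exact P.G_sub_le _ _

lemma continuous_energy : Continuous P.energy := by
  refine continuous_iff_continuousAt.2 fun v => ?_
  have hc := P.lipschitz_superposition.continuous
  rw [ContinuousAt, ← tendsto_sub_nhds_zero_iff]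
  have h1 : Filter.Tendsto (fun u => inner ℝ (P.superposition u) (u - v)) (nhds v) (nhds 0) := by
    have : Continuous fun u => (inner ℝ (P.superposition u) (u - v) : ℝ) := by fun_prop
    simpa using this.tendsto v
  have h2 : Filter.Tendsto (fun u => inner ℝ (P.superposition v) (u - v)) (nhds v) (nhds 0) := by
    have : Continuous fun u => (inner ℝ (P.superposition v) (u - v) : ℝ) := by fun_prop
    simpa using this.tendsto v
  refine tendsto_of_tendsto_of_tendsto_of_le_of_le h2 h1 (fun u => ?_) fun u =>
    P.energy_sub_le u v
  have := P.energy_sub_le v u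
  rw [← neg_sub u v, inner_neg_right] at this
  simp only
  linarith

lemma memLp_f_comp_mul (u v : L2) : MemLp (fun x => P.f (u x) * v x) 2 unitMeasure := by
  refine (Lp.memLp v).of_le_mul (c := P.B)
    ((P.lipschitz_f.continuous.comp_aestronglyMeasurable (Lp.memLp u).1).mul (Lp.memLp v).1)
    (Filter.Eventually.of_forall fun x => ?_)
  rw [norm_mul]
  exact mul_le_mul_of_nonneg_right (P.abs_f_le _) (norm_nonneg _)

/-- The function `f(u) v`, the derivative of `F(u)` when `v = u_x`. -/
noncomputable def weighted (u v : L2) : L2 := (P.memLp_f_comp_mul u v).toLp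

lemma coeFn_weighted (u v : L2) :
    ∀ᵐ x ∂unitMeasure, P.weighted u v x = P.f (u x) * v x := (P.memLp_f_comp_mul u v).coeFn_toLp

lemma integrable_f_comp_mul_sq (u v : L2) :
    Integrable (fun x => P.f (u x) * v x ^ 2) unitMeasure := by
  refine ((P.memLp_f_comp_mul u v).integrable_mul (Lp.memLp v)).congr
    (Filter.Eventually.of_forall fun x => ?_)
  simp only [Pi.mul_apply]; ring

lemma integrable_abs_F_comp_mul (u v : L2) :
    Integrable (fun x => |P.F (u x) * v x|) unitMeasure :=
  ((P.memLp_F_comp u).integrable_mul (Lp.memLp v)).abs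

lemma norm_weighted_le (u v : L2) : ‖P.weighted u v‖ ≤ P.B * ‖v‖ := by
  refine Lp.norm_le_mul_norm_of_ae_le_mul ?_
  filter_upwards [P.coeFn_weighted u v] with x hx
  rw [hx, norm_mul]
  exact mul_le_mul_of_nonneg_right (P.abs_f_le _) (norm_nonneg _)

lemma weighted_sub (u v w : L2) : P.weighted u (v - w) = P.weighted u v - P.weighted u w := by
  refine Lp.ext ?_
  filter_upwards [P.coeFn_weighted u v, P.coeFn_weighted u w, P.coeFn_weighted u (v - w),
    Lp.coeFn_sub v w, Lp.coeFn_sub (P.weighted u v) (P.weighted u w)] with x h1 h2 h3 h4 h5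
  rw [h3, h4, h5, Pi.sub_apply, Pi.sub_apply, h1, h2, mul_sub]

lemma norm_weighted_sub_le (u v : H1per) (w : L2) :
    ‖P.weighted (H1per.fn u) w - P.weighted (H1per.fn v) w‖
      ≤ P.L * (‖H1per.fn (u - v)‖ + ‖H1per.dx (u - v)‖) * ‖w‖ := by
  refine Lp.norm_le_mul_norm_of_ae_le_mul ?_
  filter_upwards [P.coeFn_weighted (H1per.fn u) w, P.coeFn_weighted (H1per.fn v) w,
    Lp.coeFn_sub (P.weighted (H1per.fn u) w) (P.weighted (H1per.fn v) w),
    Lp.coeFn_sub (H1per.fn u) (H1per.fn v), ae_abs_fn_le (u - v)] with x h1 h2 h3 h4 h5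
  rw [map_sub, h4, Pi.sub_apply, ← map_sub] at h5
  rw [h3, Pi.sub_apply, h1, h2, ← sub_mul, norm_mul]
  refine mul_le_mul_of_nonneg_right ((P.abs_f_sub_le _ _).trans ?_) (norm_nonneg _)
  exact mul_le_mul_of_nonneg_left h5 P.L.2

/-- The chain rule `F(u)_x = f(u) u_x` in `H¹_per`. -/
lemma isPeriodicWeakDeriv_superposition (u : H1per) :
    IsPeriodicWeakDeriv (P.superposition (H1per.fn u))
      (P.weighted (H1per.fn u) (H1per.dx u)) := by
  obtain ⟨U, hAC, h01, hU, hd, -⟩ := exists_absolutelyContinuous_rep u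
  refine isPeriodicWeakDeriv_of_absolutelyContinuous (U := P.F ∘ U) ?_ ?_ ?_ ?_
  · rw [absolutelyContinuousOnInterval_iff] at hAC ⊢
    intro ε hε
    obtain ⟨δ, hδ, h⟩ := hAC (ε / (P.B + 1)) (by positivity)
    refine ⟨δ, hδ, fun E hE hsum => ?_⟩
    have h1 := h E hE hsum
    rw [lt_div_iff₀ (by positivity)] at h1
    refine lt_of_le_of_lt ?_ h1
    rw [Finset.sum_mul]
    refine Finset.sum_le_sum fun i _ => (P.lipschitz_F.dist_le_mul _ _).trans ?_
    rw [mul_comm]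
    exact mul_le_mul_of_nonneg_left (by simp) dist_nonneg
  · simp [h01]
  · filter_upwards [P.coeFn_superposition (H1per.fn u), hU] with x h1 h2
    rw [h1, h2, Function.comp]
  · filter_upwards [P.coeFn_weighted (H1per.fn u) (H1per.dx u), hU, hd] with x h1 h2 h3
    rw [h1, h2]
    exact (P.hasDerivAt_F (U x)).comp x h3

/-- The superposition operator `u ↦ F(u)` on `H¹_per`. -/
noncomputable def superpositionH1 (u : H1per) : H1per :=
  ⟨WithLp.toLp 2 (P.superposition (H1per.fn u), P.weighted (H1per.fn u) (H1per.dx u)),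
    P.isPeriodicWeakDeriv_superposition u⟩

@[simp] lemma fn_superpositionH1 (u : H1per) :
    H1per.fn (P.superpositionH1 u) = P.superposition (H1per.fn u) := rfl

@[simp] lemma dx_superpositionH1 (u : H1per) :
    H1per.dx (P.superpositionH1 u) = P.weighted (H1per.fn u) (H1per.dx u) := rfl

lemma continuous_superpositionH1 : Continuous P.superpositionH1 := by
  have h1 : Continuous fun u : H1per => P.superposition (H1per.fn u) :=
    P.lipschitz_superposition.continuous.comp H1per.fn.continuous
  have h2 : Continuous fun u : H1per => P.weighted (H1per.fn u) (H1per.dx u) := by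
    refine continuous_iff_continuousAt.2 fun v => ?_
    rw [ContinuousAt, tendsto_iff_norm_sub_tendsto_zero]
    have hlim : Filter.Tendsto (fun u : H1per => P.B * ‖H1per.dx (u - v)‖
        + P.L * (‖H1per.fn (u - v)‖ + ‖H1per.dx (u - v)‖) * ‖H1per.dx v‖) (nhds v) (nhds 0) := by
      have : Continuous fun u : H1per => P.B * ‖H1per.dx (u - v)‖
        + P.L * (‖H1per.fn (u - v)‖ + ‖H1per.dx (u - v)‖) * ‖H1per.dx v‖ := by fun_prop
      simpa using this.tendsto v
    refine squeeze_zero (fun u => norm_nonneg _) (fun u => ?_) hlim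
    have e : P.weighted (H1per.fn u) (H1per.dx u) - P.weighted (H1per.fn v) (H1per.dx v)
        = P.weighted (H1per.fn u) (H1per.dx (u - v))
          + (P.weighted (H1per.fn u) (H1per.dx v) - P.weighted (H1per.fn v) (H1per.dx v)) := by
      rw [map_sub, P.weighted_sub]; abel
    rw [e]
    exact (norm_add_le _ _).trans
      (add_le_add (P.norm_weighted_le _ _) (P.norm_weighted_sub_le u v _))
  exact ((WithLp.prod_continuous_toLp 2 L2 L2).comp (h1.prodMk h2)).subtype_mk _

lemma norm_superpositionH1_le (u : H1per) :
    ‖P.superpositionH1 u‖ ≤ ‖P.superposition 0‖ + 2 * P.B * ‖u‖ := by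
  have hle : ∀ v : H1per, ‖H1per.fn v‖ ≤ ‖v‖ ∧ ‖H1per.dx v‖ ≤ ‖v‖ ∧
      ‖v‖ ≤ ‖H1per.fn v‖ + ‖H1per.dx v‖ := by
    intro v
    have h : ‖v‖ ^ 2 = ‖H1per.fn v‖ ^ 2 + ‖H1per.dx v‖ ^ 2 :=
      WithLp.prod_norm_sq_eq_of_L2 (v : WithLp 2 (L2 × L2))
    have h1 := norm_nonneg v
    have h2 := norm_nonneg (H1per.fn v)
    have h3 := norm_nonneg (H1per.dx v)
    exact ⟨by nlinarith, by nlinarith, by nlinarith⟩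
  have h1 := P.norm_superposition_sub_le (H1per.fn u) 0
  have h2 := norm_add_le (P.superposition (H1per.fn u) - P.superposition 0) (P.superposition 0)
  rw [sub_add_cancel] at h2
  rw [sub_zero] at h1
  have h3 := P.norm_weighted_le (H1per.fn u) (H1per.dx u)
  have h4 := mul_le_mul_of_nonneg_left (hle u).1 P.B.2
  have h5 := mul_le_mul_of_nonneg_left (hle u).2.1 P.B.2
  have h6 := (hle (P.superpositionH1 u)).2.2
  simp only [fn_superpositionH1, dx_superpositionH1] at h6
  simp only [NNReal.val_eq_coe] at h4 h5
  linarith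

end ConvexProfile

/-! ### Passing from increments to an integrated inequality -/

section Increments

variable {X : Type*} [NormedAddCommGroup X] [NormedSpace ℝ X]

/-- The correlation `r ↦ ∫ g(t - r)(Z t) dt` of square integrable functions is continuous. -/
lemma continuous_correlation (g : Lp (StrongDual ℝ X) 2 (volume : Measure ℝ))
    (Z : Lp X 2 (volume : Measure ℝ)) : Continuous fun r : ℝ => ∫ t, g (t - r) (Z t) := by
  let τ : ℝ → C(ℝ, ℝ) := fun r => ⟨fun t => t - r, by fun_prop⟩
  have hτ : Continuous τ :=
    ContinuousMap.continuous_of_continuous_uncurry _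
      (by simp only [Function.uncurry_def, τ, ContinuousMap.coe_mk]; fun_prop)
  have hmp : ∀ r, MeasurePreserving (τ r) volume volume := fun r =>
    measurePreserving_sub_right volume r
  have h1 : Continuous fun r => Lp.compMeasurePreserving (τ r) (hmp r) g :=
    continuous_const.compMeasurePreservingLp hτ hmp (by norm_num)
  have h2 := ((ContinuousLinearMap.lpPairing (μ := (volume : Measure ℝ)) 2 2
    (ContinuousLinearMap.id ℝ (StrongDual ℝ X))).flip Z).continuous.comp h1
  convert! h2 using 1
  ext r
  simp only [Function.comp, ContinuousLinearMap.flip_apply]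
  rw [ContinuousLinearMap.lpPairing_eq_integral]
  refine integral_congr_ae ?_
  filter_upwards [Lp.coeFn_compMeasurePreserving g (hmp r)] with t ht
  rw [ht]
  rfl

lemma integrable_pairing {μ : Measure ℝ} {g : ℝ → StrongDual ℝ X} {Z : ℝ → X}
    (hg : MemLp g 2 μ) (hZ : MemLp Z 2 μ) : Integrable (fun t => g t (Z t)) μ :=
  memLp_one_iff_integrable.1
    ((ContinuousLinearMap.id ℝ (StrongDual ℝ X)).memLp_of_bilin 1 hg hZ)

/-- The average over `r` of the correlations of `g` and `Z` is the integral of the pairings of `Z t`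
with the integrals of `g` over `[t - h, t]`, by Fubini's theorem. -/
lemma integral_correlation (g : Lp (StrongDual ℝ X) 2 (volume : Measure ℝ))
    (Z : Lp X 2 (volume : Measure ℝ)) {h : ℝ} (hh : 0 ≤ h) :
    Integrable (fun t => ∫ ρ in (t - h)..t, g ρ (Z t)) ∧
    ∫ r in (0 : ℝ)..h, ∫ t, g (t - r) (Z t) = ∫ t, ∫ ρ in (t - h)..t, g ρ (Z t) := by
  set ν := volume.restrict (Ioc (0 : ℝ) h)
  have hgm : AEStronglyMeasurable (fun p : ℝ × ℝ => g (p.1 - p.2)) (volume.prod ν) :=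
    ((Lp.stronglyMeasurable g).comp_measurable (measurable_fst.sub measurable_snd)
      ).aestronglyMeasurable
  have hZm : AEStronglyMeasurable (fun p : ℝ × ℝ => Z p.1) (volume.prod ν) :=
    ((Lp.stronglyMeasurable Z).comp_measurable measurable_fst).aestronglyMeasurable
  have hm : AEStronglyMeasurable (fun p : ℝ × ℝ => g (p.1 - p.2) (Z p.1)) (volume.prod ν) :=
    (ContinuousLinearMap.id ℝ (StrongDual ℝ X)).aestronglyMeasurable_comp₂ hgm hZm
  have hshift : ∀ r : ℝ, MemLp (fun t => g (t - r)) 2 volume := fun r =>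
    (Lp.memLp g).comp_measurePreserving (measurePreserving_sub_right volume r)
  have hsq : ∀ r : ℝ, ∫ t, ‖g (t - r)‖ ^ 2 = ∫ t, ‖g t‖ ^ 2 := fun r =>
    integral_sub_right_eq_self (fun t => ‖g t‖ ^ 2) r
  have hi2 : ∀ {Y : Type _} [NormedAddCommGroup Y] {u : ℝ → Y}, MemLp u 2 volume →
      Integrable fun t => ‖u t‖ ^ 2 := fun hu => (memLp_two_iff_integrable_sq_norm hu.1).1 hu
  have hpt : ∀ r : ℝ, Integrable (fun t => g (t - r) (Z t)) := fun r =>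
    integrable_pairing (hshift r) (Lp.memLp Z)
  have hbound : ∀ r : ℝ, ∫ t, ‖g (t - r) (Z t)‖ ≤ (∫ t, ‖g t‖ ^ 2) + ∫ t, ‖Z t‖ ^ 2 := by
    intro r
    rw [← hsq r, ← integral_add (hi2 (hshift r)) (hi2 (Lp.memLp Z))]
    refine integral_mono (hpt r).norm ((hi2 (hshift r)).add (hi2 (Lp.memLp Z))) fun t => ?_
    refine ((g (t - r)).le_opNorm _).trans ?_
    nlinarith [sq_nonneg (‖g (t - r)‖ - ‖Z t‖), sq_nonneg ‖g (t - r)‖, sq_nonneg ‖Z t‖]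
  have hint : Integrable (fun p : ℝ × ℝ => g (p.1 - p.2) (Z p.1)) (volume.prod ν) := by
    rw [integrable_prod_iff' hm]
    refine ⟨Filter.Eventually.of_forall fun r => hpt r, ?_⟩
    refine Integrable.mono' (integrable_const ((∫ t, ‖g t‖ ^ 2) + ∫ t, ‖Z t‖ ^ 2))
      hm.norm.prod_swap.integral_prod_right' (Filter.Eventually.of_forall fun r => ?_)
    rw [Real.norm_of_nonneg (integral_nonneg fun t => norm_nonneg _)]
    exact hbound r
  have hinner : ∀ t : ℝ, ∫ r, g (t - r) (Z t) ∂ν = ∫ ρ in (t - h)..t, g ρ (Z t) := by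
    intro t
    rw [← intervalIntegral.integral_of_le hh,
      intervalIntegral.integral_comp_sub_left (fun ρ => g ρ (Z t)) t, sub_zero]
  constructor
  · have := hint.integral_prod_left
    simpa only [hinner] using this
  · rw [intervalIntegral.integral_of_le hh,
      integral_integral_swap (μ := ν) (ν := volume) (f := fun r t => g (t - r) (Z t)) hint.swap]
    simp only [ν, hinner]

lemma exists_Lp_zero_extension {Y : Type*} [NormedAddCommGroup Y] {u : ℝ → Y} {S : Set ℝ}
    (hS : MeasurableSet S) (hu : MemLp u 2 (volume.restrict S)) :
    ∃ v : Lp Y 2 (volume : Measure ℝ), ∀ᵐ t, (t ∈ S → v t = u t) ∧ (t ∉ S → v t = 0) := by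
  have h : MemLp (S.indicator u) 2 volume := (memLp_indicator_iff_restrict hS).2 hu
  refine ⟨h.toLp, ?_⟩
  filter_upwards [h.coeFn_toLp] with t ht
  rw [ht]
  exact ⟨fun h' => indicator_of_mem h' u, fun h' => indicator_of_notMem h' u⟩

/-- If the backward increments of a continuous function `E` are, at almost every time, bounded by
the integral of `g(ρ)(Z t)` over `ρ ∈ [t - r, t]`, then `E T - E s` is bounded by the
integral of `g(t)(Z t)`. No differentiability of `E` is involved: the inequality is averaged over
`t`, and `r → 0` by continuity of translations in `L²`. -/
lemma sub_le_integral_of_increments {E : ℝ → ℝ} {g : ℝ → StrongDual ℝ X} {Z : ℝ → X} {s T : ℝ}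
    (hs : 0 < s) (hsT : s < T) (hE : ContinuousOn E (Ioi 0))
    (hg : MemLp g 2 (volume.restrict (Icc (s / 2) T)))
    (hZ : MemLp Z 2 (volume.restrict (Icc s T)))
    (hinc : ∀ᵐ t ∂(volume.restrict (Icc s T)), ∀ r ∈ Ioo 0 (s / 2),
      E t - E (t - r) ≤ ∫ ρ in (t - r)..t, g ρ (Z t)) :
    E T - E s ≤ ∫ t in Icc s T, g t (Z t) := by
  obtain ⟨g₁, eg₁⟩ := exists_Lp_zero_extension measurableSet_Icc hg
  obtain ⟨Z₁, eZ⟩ := exists_Lp_zero_extension measurableSet_Icc hZ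
  have eg : ∀ᵐ ρ, ρ ∈ Icc (s / 2) T → g₁ ρ = g ρ := eg₁.mono fun ρ h => h.1
  set c : ℝ → ℝ := fun r => ∫ t, g₁ (t - r) (Z₁ t) with hc
  have hcc : Continuous c := continuous_correlation g₁ Z₁
  have hc0 : c 0 = ∫ t in Icc s T, g t (Z t) := by
    rw [← integral_indicator measurableSet_Icc]
    refine integral_congr_ae ?_
    filter_upwards [eg, eZ] with t h1 h2
    by_cases ht : t ∈ Icc s T
    · simp only [sub_zero]
      rw [h2.1 ht, h1 ⟨by linarith [ht.1], ht.2⟩, indicator_of_mem ht]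
    · rw [h2.2 ht, indicator_of_notMem ht, map_zero]
  have hEi : ∀ a b : ℝ, 0 < a → 0 < b → IntervalIntegrable E volume a b := fun a b ha hb =>
    (hE.mono fun x hx => lt_of_lt_of_le (lt_min ha hb) hx.1).intervalIntegrable
  have hstep : ∀ h ∈ Ioo 0 (s / 2),
      (∫ t in s..T, E t) - (∫ t in s..(T - h), E t) + (∫ t in s..(s - h), E t)
        - ∫ r in (0 : ℝ)..h, c r ≤ 0 := by
    intro h hh
    obtain ⟨hcorr, hcorr'⟩ := integral_correlation g₁ Z₁ hh.1.le
    have hzero : ∀ᵐ t, t ∉ Ioc s T → ∫ ρ in (t - h)..t, g₁ ρ (Z₁ t) = 0 := by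
      filter_upwards [eZ, Measure.ae_ne volume s] with t h2 hts ht
      have : t ∉ Icc s T := fun h' => ht ⟨lt_of_le_of_ne h'.1 (Ne.symm hts), h'.2⟩
      simp [h2.2 this]
    have hEshift : IntervalIntegrable (fun t => E (t - h)) volume s T := by
      have := (hEi (s - h) (T - h) (by linarith [hh.2]) (by linarith [hh.2])).comp_sub_right h
      simpa using this
    have hmono : ∫ t in s..T, (E t - E (t - h)) ≤ ∫ t in s..T, ∫ ρ in (t - h)..t, g₁ ρ (Z₁ t) := by
      refine intervalIntegral.integral_mono_ae_restrict hsT.le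
        ((hEi s T hs (hs.trans hsT)).sub hEshift) hcorr.intervalIntegrable ?_
      filter_upwards [hinc, ae_restrict_of_ae eZ, ae_restrict_mem measurableSet_Icc]
        with t h1 h2 ht
      refine (h1 h hh).trans (le_of_eq ?_)
      rw [h2.1 ht]
      refine intervalIntegral.integral_congr_ae ?_
      filter_upwards [eg] with ρ h3 hρ
      rw [uIoc_of_le (by linarith [hh.1])] at hρ
      rw [h3 ⟨by linarith [hρ.1, ht.1, hh.2], by linarith [hρ.2, ht.2]⟩]
    have hfull : ∫ t in s..T, ∫ ρ in (t - h)..t, g₁ ρ (Z₁ t) = ∫ r in (0 : ℝ)..h, c r := by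
      rw [hcorr', intervalIntegral.integral_of_le hsT.le]
      refine setIntegral_eq_integral_of_ae_compl_eq_zero ?_
      exact hzero
    rw [intervalIntegral.integral_sub (hEi s T hs (hs.trans hsT)) hEshift,
      intervalIntegral.integral_comp_sub_right E h, hfull] at hmono
    have e := intervalIntegral.integral_interval_sub_left
      (hEi s (T - h) hs (by linarith [hh.2])) (hEi s (s - h) hs (by linarith [hh.2]))
    linarith
  have hprim : ∀ x : ℝ, 0 < x → HasDerivAt (fun u => ∫ t in s..u, E t) (E x) x := fun x hx =>
    intervalIntegral.integral_hasDerivAt_right (hEi s x hs hx)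
      (hE.stronglyMeasurableAtFilter isOpen_Ioi x hx) (hE.continuousAt (Ioi_mem_nhds hx))
  -- the averaged inequality is divided by `h`, and `h → 0` from the right
  have hQ : HasDerivAt (fun h => (∫ t in s..T, E t) - (∫ t in s..(T - h), E t)
      + (∫ t in s..(s - h), E t) - ∫ r in (0 : ℝ)..h, c r) (E T - E s - c 0) 0 := by
    have d1 : HasDerivAt (fun h => ∫ t in s..(T - h), E t) (-E T) 0 := by
      have hx := hprim (T - 0) (by linarith)
      simpa using hx.comp_const_sub T 0
    have d2 : HasDerivAt (fun h => ∫ t in s..(s - h), E t) (-E s) 0 := by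
      have hx := hprim (s - 0) (by linarith)
      simpa using hx.comp_const_sub s 0
    have d3 : HasDerivAt (fun h => ∫ r in (0 : ℝ)..h, c r) (c 0) 0 :=
      (hcc.integral_hasStrictDerivAt 0 0).hasDerivAt
    convert! ((d1.const_sub (∫ t in s..T, E t)).add d2).sub d3 using 1
    ring
  have hlim := (hasDerivWithinAt_iff_tendsto_slope' (s := Ioi (0 : ℝ)) (by simp)).1
    hQ.hasDerivWithinAt
  have : E T - E s - c 0 ≤ 0 := by
    refine le_of_tendsto hlim ?_
    filter_upwards [Ioo_mem_nhdsGT (show (0 : ℝ) < s / 2 by linarith)] with h hh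
    rw [slope_def_field]
    refine div_nonpos_of_nonpos_of_nonneg ?_ (by linarith [hh.1])
    have := hstep h hh
    simpa using this
  rw [← hc0]
  linarith

end Increments

/-! ### Distributional time derivatives -/

lemma MemL2loc.integrableOn {X : Type*} [NormedAddCommGroup X] {f : ℝ → X} (hf : MemL2loc f)
    {p q : ℝ} (hp : 0 < p) (hpq : p < q) : IntegrableOn f (Icc p q) :=
  (hf p q hp hpq).integrable (by norm_num)

/-- A continuous vector-valued function is, after a continuous linear functional is applied, the
primitive of its distributional time derivative. -/
lemma apply_sub_apply_eq_integral {V : Type*} [NormedAddCommGroup V] [NormedSpace ℝ V]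
    [CompleteSpace V] {W g' : ℝ → V} (hWc : ContinuousOn W (Ici 0)) (hyτ : MemL2loc g')
    (hw : IsWeakTimeDeriv W g') {s t : ℝ} (hs : 0 < s) (hst : s < t) (ℓ : V →L[ℝ] ℝ) :
    ℓ (W t) - ℓ (W s) = ∫ ρ in s..t, ℓ (g' ρ) := by
  set α := s / 2
  set β := t + 1
  have hα : 0 < α := by simp only [α]; linarith
  have hαs : α < s := by simp only [α]; linarith
  have htβ : t < β := by simp only [β]; linarith
  have hαβ : α < β := by linarith
  set u : ℝ → ℝ := fun τ => ℓ (W τ)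
  set g : ℝ → ℝ := fun τ => ℓ (g' τ)
  have huc : ContinuousOn u (Ici 0) :=
    ℓ.continuous.comp_continuousOn hWc
  have hgi : IntegrableOn g (Icc α β) :=
    ℓ.integrable_comp (hyτ.integrableOn hα hαβ)
  have hui : IntegrableOn u (Ioo α β) :=
    ((huc.mono fun x hx => hα.le.trans hx.1).integrableOn_compact isCompact_Icc).mono_set
      Ioo_subset_Icc_self
  obtain ⟨c, hc⟩ := ae_eq_const_add_integral_of_weakDeriv hαβ hui
    (hgi.mono_set Ioo_subset_Icc_self) (by
      intro φ h1 h2 h3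
      obtain ⟨p, q, hp, hpq, hq, hz⟩ := exists_Icc_of_tsupport_subset hαβ h2 h3
      have hd : Continuous (deriv φ) := h1.continuous_deriv (by simp)
      obtain ⟨p', q', hp', hpq', hq', hz'⟩ := exists_Icc_of_tsupport_subset hαβ h2.deriv
        ((tsupport_deriv_subset (f := φ)).trans h3)
      have hsub : Ioo α β ⊆ Ioi 0 := fun x hx => hα.trans hx.1
      have restrict : ∀ (ψ w : ℝ → ℝ), (∀ x, x ∉ Ioo α β → ψ x = 0) →
          ∫ x in Ioi (0 : ℝ), ψ x * w x = ∫ x in Ioo α β, w x * ψ x := by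
        intro ψ w hψ
        rw [← setIntegral_eq_of_subset_of_forall_sdiff_eq_zero measurableSet_Ioi hsub]
        · simp only [mul_comm]
        · intro x hx
          simp [hψ x hx.2]
      have i1 : IntegrableOn (fun τ => deriv φ τ • W τ) (Ioi 0) := by
        refine Integrable.integrableOn ?_
        rw [← integrableOn_iff_integrable_of_support_subset (s := Icc p' q')]
        · exact ((hd.continuousOn).smul (hWc.mono fun x hx =>
            (hα.trans (hp'.trans_le hx.1)).le)).integrableOn_compact isCompact_Icc
        · intro x hx
          by_contra hne
          exact hx (by simp [hz' x hne])
      have i2 : IntegrableOn (fun τ => φ τ • g' τ) (Ioi 0) := by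
        refine Integrable.integrableOn ?_
        rw [← integrableOn_iff_integrable_of_support_subset (s := Icc p q)]
        · exact (hyτ.integrableOn (hα.trans hp) hpq).continuousOn_smul
            h1.continuous.continuousOn isCompact_Icc
        · intro x hx
          by_contra hne
          exact hx (by simp [hz x hne])
      have h4 := congrArg ℓ (hw φ h1 h2 (h3.trans hsub))
      rw [map_neg, ← ℓ.integral_comp_comm i1, ← ℓ.integral_comp_comm i2] at h4
      simp only [map_smul, smul_eq_mul] at h4
      rw [restrict _ _ fun x hx => hz' x fun h' => hx ⟨hp'.trans_le h'.1, h'.2.trans_lt hq'⟩,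
        restrict _ _ fun x hx => hz x fun h' => hx ⟨hp.trans_le h'.1, h'.2.trans_lt hq⟩] at h4
      exact h4)
  have hgii : IntervalIntegrable g volume α β := by
    rw [intervalIntegrable_iff_integrableOn_Icc_of_le hαβ.le]; exact hgi
  have hprim : ContinuousOn (fun x => c + ∫ t in α..x, g t) (Ioo α β) := by
    refine continuousOn_const.add ?_
    have := intervalIntegral.continuousOn_primitive_interval (μ := volume) (f := g) (a := α)
      (b := β) (by rw [uIcc_of_le hαβ.le]; exact hgi)
    rw [uIcc_of_le hαβ.le] at this
    exact this.mono Ioo_subset_Icc_self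
  have heq : EqOn u (fun x => c + ∫ t in α..x, g t) (Ioo α β) := by
    refine Measure.eqOn_open_of_ae_eq (μ := volume) ?_ isOpen_Ioo
      (huc.mono fun x hx => (hα.trans hx.1).le) hprim
    exact (ae_restrict_iff' measurableSet_Ioo).2 hc
  have e1 := heq (x := t) ⟨hαs.trans hst, htβ⟩
  have e2 := heq (x := s) ⟨hαs, hst.trans htβ⟩
  have e3 := intervalIntegral.integral_interval_sub_left
    (hgii.mono_set (c := α) (d := t) (by
      rw [uIcc_of_le hαβ.le, uIcc_of_le (hαs.trans hst).le]
      exact Icc_subset_Icc_right htβ.le))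
    (hgii.mono_set (c := α) (d := s) (by
      rw [uIcc_of_le hαβ.le, uIcc_of_le hαs.le]
      exact Icc_subset_Icc_right (hst.trans htβ).le))
  rw [← e3]
  simp only [u] at e1 e2
  linarith

/-! ### Weak solutions -/

instance : SecondCountableTopology H1per := by
  have : Fact ((2 : ℝ≥0∞) ≠ ⊤) := ⟨by norm_num⟩
  have h : Topology.IsInducing fun u : H1per => WithLp.ofLp (u : WithLp 2 (L2 × L2)) :=
    (WithLp.homeomorphProd 2 L2 L2).isInducing.comp Topology.IsInducing.subtypeVal
  exact h.secondCountableTopology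

lemma toH1perDual_apply (v : L2) (z : H1per) : toH1perDual v z = inner ℝ v (H1per.fn z) := rfl

lemma integral_mul_eq_inner (u v : L2) :
    ∫ x in Ioo (0 : ℝ) 1, u x * v x = inner ℝ u v := by
  rw [L2.inner_def]
  refine integral_congr_ae (Filter.Eventually.of_forall fun x => ?_)
  simp [mul_comm]

lemma inner_sub_eq_integral {y : ℝ → L2} {yτ : ℝ → H1perDual} (hy : ContinuousOn y (Ici 0))
    (hyτ : MemL2loc yτ) (hw : IsWeakTimeDeriv (fun τ => toH1perDual (y τ)) yτ)
    {s t : ℝ} (hs : 0 < s) (hst : s < t) (z : H1per) :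
    inner ℝ (y t - y s) (H1per.fn z) = ∫ ρ in s..t, yτ ρ z := by
  have hc : Continuous toH1perDual := by unfold toH1perDual; fun_prop
  rw [inner_sub_left, ← toH1perDual_apply, ← toH1perDual_apply]
  exact apply_sub_apply_eq_integral (hc.comp_continuousOn hy) hyτ hw hs hst
    (ContinuousLinearMap.apply ℝ ℝ z)

/-- The product of an element of `Ḣ¹` and an element of `L²` is in `L²`. -/
lemma Hdot1.memLp_mul (a : Hdot1) (v : L2) :
    MemLp (fun x => Hdot1.fn a x * v x) 2 unitMeasure := by
  refine (Lp.memLp v).of_le_mul (c := ‖a‖) ((Lp.memLp (Hdot1.fn a)).1.mul (Lp.memLp v).1) ?_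
  filter_upwards [a.ae_abs_fn_le] with x hx
  rw [norm_mul]
  exact mul_le_mul_of_nonneg_right hx (norm_nonneg _)

lemma Hdot1.integral_mul_mul_eq_inner (a : Hdot1) (v w : L2) :
    ∫ x in Ioo (0 : ℝ) 1, Hdot1.fn a x * v x * w x = inner ℝ ((a.memLp_mul v).toLp) w := by
  rw [← integral_mul_eq_inner]
  refine integral_congr_ae ?_
  filter_upwards [(a.memLp_mul v).coeFn_toLp] with x hx
  rw [hx]

/-- By separability of `H¹_per` the exceptional set of times in the weak formulation can be chosen
independently of the test function. -/
lemma ae_forall_weak_formulation {a : ℝ → Hdot1} {Y : ℝ → H1per} {yτ : ℝ → H1perDual}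
    (h : ∀ z : H1per, ∀ᵐ τ ∂(volume.restrict (Ioi (0 : ℝ))),
      yτ τ z
        + (∫ x in Ioo (0 : ℝ) 1, H1per.dx (Y τ) x * H1per.dx z x)
        - (∫ x in Ioo (0 : ℝ) 1, Hdot1.fn (a τ) x * H1per.dx (Y τ) x * H1per.fn z x) = 0) :
    ∀ᵐ τ ∂(volume.restrict (Ioi (0 : ℝ))), ∀ z : H1per,
      yτ τ z
        + (∫ x in Ioo (0 : ℝ) 1, H1per.dx (Y τ) x * H1per.dx z x)
        - (∫ x in Ioo (0 : ℝ) 1, Hdot1.fn (a τ) x * H1per.dx (Y τ) x * H1per.fn z x) = 0 := by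
  have hd := TopologicalSpace.denseRange_denseSeq H1per
  filter_upwards [ae_all_iff.2 fun n => h (TopologicalSpace.denseSeq H1per n)] with τ hτ z
  refine congrFun (hd.equalizer (g := fun z : H1per => yτ τ z
        + (∫ x in Ioo (0 : ℝ) 1, H1per.dx (Y τ) x * H1per.dx z x)
        - (∫ x in Ioo (0 : ℝ) 1, Hdot1.fn (a τ) x * H1per.dx (Y τ) x * H1per.fn z x))
      (h := fun _ => 0) ?_ continuous_const (funext hτ)) z
  simp only [integral_mul_eq_inner, Hdot1.integral_mul_mul_eq_inner]
  fun_prop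

/-- The energy inequality for `∫ G(y)` with `G` convex, for which `F(y)` is used as a test function.
The function `k` is any integrable bound for the dissipation plus the drift, where the drift
coefficient is estimated by `M`; in this form the time measurability of the two terms is not
needed. -/
lemma IsWeakSolution.energy_inequality {a : ℝ → Hdot1} {M : ℝ}
    (haM : ∀ τ : ℝ, 0 ≤ τ → ‖a τ‖ ≤ M) {y₀ : ℝ → ℝ} {y : ℝ → L2}
    (hy : IsWeakSolution a y₀ y) :
    ∃ Y : ℝ → H1per, (∀ᵐ τ ∂(volume.restrict (Ioi (0 : ℝ))), H1per.fn (Y τ) = y τ) ∧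
      ∀ (P : ConvexProfile) (s T : ℝ) (k : ℝ → ℝ), 0 < s → s < T → IntegrableOn k (Icc s T) →
      (∀ᵐ t ∂(volume.restrict (Icc s T)),
        ∫ x, (-(P.f (H1per.fn (Y t) x) * H1per.dx (Y t) x ^ 2)
          + M * |P.F (H1per.fn (Y t) x) * H1per.dx (Y t) x|) ∂unitMeasure ≤ k t) →
      P.energy (y T) - P.energy (y s) ≤ ∫ t in Icc s T, k t := by
  obtain ⟨hyc, -, Y, yτ, hY, hYy, hyτ, hw, heq⟩ := hy
  refine ⟨Y, hYy, fun P s T k hs hsT hk hbound => ?_⟩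
  have hsub : Icc s T ⊆ Ioi 0 := fun t ht => hs.trans_le ht.1
  have hYs := hY s T hs hsT
  set Z : ℝ → H1per := fun t => P.superpositionH1 (Y t)
  have hZ : MemLp Z 2 (volume.restrict (Icc s T)) := by
    have h1 : MemLp (fun t => ‖P.superposition 0‖ + 2 * P.B * ‖Y t‖) 2
        (volume.restrict (Icc s T)) :=
      MemLp.add (f := fun _ => ‖P.superposition 0‖) (g := fun t => 2 * P.B * ‖Y t‖)
        (memLp_const _) (hYs.norm.const_mul (2 * P.B : ℝ))
    refine h1.mono (P.continuous_superpositionH1.comp_aestronglyMeasurable hYs.1)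
      (Filter.Eventually.of_forall fun t => ?_)
    exact (P.norm_superpositionH1_le _).trans (le_abs_self _)
  have hE : ContinuousOn (fun t => P.energy (y t)) (Ioi 0) :=
    P.continuous_energy.comp_continuousOn (hyc.mono Ioi_subset_Ici_self)
  have hsub' := Measure.restrict_mono_set volume hsub
  have hmain := sub_le_integral_of_increments (g := yτ) hs hsT hE
    (hyτ (s / 2) T (by linarith) (by linarith)) hZ (by
      filter_upwards [ae_mono hsub' hYy, ae_restrict_mem measurableSet_Icc] with t ht htI r hr
      refine (P.energy_sub_le _ _).trans (le_of_eq ?_)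
      rw [← inner_sub_eq_integral hyc hyτ hw (by linarith [htI.1, hr.2]) (by linarith [hr.1]),
        P.fn_superpositionH1, ht, real_inner_comm])
  refine hmain.trans (integral_mono_ae ?_ hk ?_)
  · exact integrable_pairing (hyτ s T hs hsT) hZ
  · filter_upwards [ae_mono hsub' (ae_forall_weak_formulation heq), hbound,
      ae_restrict_mem measurableSet_Icc] with t ht hb htI
    refine le_trans ?_ hb
    have h0 := ht (Z t)
    simp only [Z, P.fn_superpositionH1, P.dx_superpositionH1] at h0 ⊢
    set v := H1per.dx (Y t)
    set u := H1per.fn (Y t)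
    have e1 : ∫ x in Ioo (0 : ℝ) 1, v x * P.weighted u v x
        = ∫ x, P.f (u x) * v x ^ 2 ∂unitMeasure := by
      refine integral_congr_ae ?_
      filter_upwards [P.coeFn_weighted u v] with x hx
      rw [hx]; ring
    have i1 := P.integrable_f_comp_mul_sq u v
    have i2 := P.integrable_abs_F_comp_mul u v
    have e2 : ∫ x in Ioo (0 : ℝ) 1, Hdot1.fn (a t) x * v x * P.superposition u x
        ≤ ∫ x, M * |P.F (u x) * v x| ∂unitMeasure := by
      refine integral_mono_ae (((a t).memLp_mul v).integrable_mul (Lp.memLp _))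
        (i2.const_mul M) ?_
      filter_upwards [P.coeFn_superposition u, (a t).ae_abs_fn_le] with x hx hax
      rw [hx]
      refine (le_abs_self _).trans ?_
      rw [mul_assoc, abs_mul, mul_comm (v x)]
      exact mul_le_mul_of_nonneg_right (hax.trans (haM t (hs.le.trans htI.1))) (abs_nonneg _)
    have e3 : ∫ x, (-(P.f (u x) * v x ^ 2) + M * |P.F (u x) * v x|) ∂unitMeasure
        = -(∫ x, P.f (u x) * v x ^ 2 ∂unitMeasure) + ∫ x, M * |P.F (u x) * v x| ∂unitMeasure := by
      rw [← integral_neg]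
      exact integral_add i1.neg (i2.const_mul M)
    rw [e3]
    linarith

/-! ### The weak maximum principle -/

namespace ConvexProfile

/-- The profile with second derivative `f` and with `F c = p`, `G c = q`. -/
noncomputable def ofSecondDeriv (f : ℝ → ℝ) (B L : NNReal) (h0 : ∀ s, 0 ≤ f s) (hB : ∀ s, f s ≤ B)
    (hL : LipschitzWith L f) (c p q : ℝ) : ConvexProfile where
  f := f
  F := fun s => p + ∫ x in c..s, f x
  G := fun s => q + ∫ x in c..s, (p + ∫ t in c..x, f t)
  B := B
  L := L
  hasDerivAt_F := fun s => (hL.continuous.integral_hasStrictDerivAt c s).hasDerivAt.const_add p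
  hasDerivAt_G := fun s => by
    have hc : Continuous fun x => p + ∫ t in c..x, f t :=
      continuous_iff_continuousAt.2 fun x =>
        ((hL.continuous.integral_hasStrictDerivAt c x).hasDerivAt.const_add p).continuousAt
    exact (hc.integral_hasStrictDerivAt c s).hasDerivAt.const_add q
  f_nonneg := h0
  f_le := hB
  lipschitz_f := hL

/-- A profile with `G = 0` on `(-∞, c]` and `G > 0` on `(c, ∞)`; its second derivative is
`min (s - c)⁺ 1`. -/
noncomputable def posPart (c : ℝ) : ConvexProfile :=
  ofSecondDeriv (fun s => min (max (s - c) 0) 1) 1 1 (fun s => by positivity)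
    (fun s => by simp)
    (by
      have h : LipschitzWith 1 fun s : ℝ => s - c :=
        LipschitzWith.of_dist_le_mul fun x y => by simp
      exact (h.max_const 0).min_const 1) c 0 0

lemma posPart_f (c s : ℝ) : (posPart c).f s = min (max (s - c) 0) 1 := rfl

lemma posPart_f_mono (c : ℝ) : Monotone (posPart c).f := by
  intro s t h
  simp only [posPart_f]
  gcongr

lemma posPart_F_self (c : ℝ) : (posPart c).F c = 0 := by simp [posPart, ofSecondDeriv]

lemma posPart_G_self (c : ℝ) : (posPart c).G c = 0 := by simp [posPart, ofSecondDeriv]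

lemma posPart_F_of_le {c s : ℝ} (h : s ≤ c) : (posPart c).F s = 0 := by
  have : ∫ x in c..s, (posPart c).f x = ∫ x in c..s, (0 : ℝ) := by
    refine intervalIntegral.integral_congr fun x hx => ?_
    rw [uIcc_of_ge h] at hx
    simp only [posPart_f]
    rw [max_eq_right (by linarith [hx.2]), min_eq_left zero_le_one]
  have e : (posPart c).F s = 0 + ∫ x in c..s, (posPart c).f x := rfl
  rw [e, this]
  simp

lemma posPart_G_of_le {c s : ℝ} (h : s ≤ c) : (posPart c).G s = 0 := by
  have : ∫ x in c..s, (posPart c).F x = ∫ x in c..s, (0 : ℝ) := by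
    refine intervalIntegral.integral_congr fun x hx => ?_
    rw [uIcc_of_ge h] at hx
    exact posPart_F_of_le hx.2
  have e : (posPart c).G s = 0 + ∫ x in c..s, (posPart c).F x := rfl
  rw [e, this]
  simp

lemma posPart_F_nonneg (c s : ℝ) : 0 ≤ (posPart c).F s := by
  rcases le_total s c with h | h
  · rw [posPart_F_of_le h]
  · rw [← posPart_F_self c]; exact (posPart c).monotone_F h

/-- The inequality that allows the drift term to be absorbed; it holds because the second
derivative is nondecreasing. -/
lemma posPart_F_sq_le (c s : ℝ) :
    (posPart c).F s ^ 2 ≤ 2 * (posPart c).f s * (posPart c).G s := by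
  set P := posPart c
  rcases le_total s c with h | h
  · simp only [P, posPart_F_of_le h, posPart_G_of_le h]; simp
  have hd : ∀ x, HasDerivAt (fun x => 2 * P.f s * P.G x - P.F x ^ 2)
      (2 * P.f s * P.F x - 2 * P.F x * P.f x) x := fun x => by
    have := ((P.hasDerivAt_G x).const_mul (2 * P.f s)).sub ((P.hasDerivAt_F x).pow 2)
    convert! this using 1
    norm_num
  have hmono : MonotoneOn (fun x => 2 * P.f s * P.G x - P.F x ^ 2) (Icc c s) := by
    refine monotoneOn_of_deriv_nonneg (convex_Icc c s)
      (fun x _ => (hd x).continuousAt.continuousWithinAt)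
      (fun x _ => (hd x).differentiableAt.differentiableWithinAt) fun x hx => ?_
    rw [interior_Icc] at hx
    rw [(hd x).deriv]
    have h1 := posPart_f_mono c hx.2.le
    have h2 := posPart_F_nonneg c x
    nlinarith [mul_nonneg h2 (sub_nonneg.2 h1)]
  have := hmono (left_mem_Icc.2 h) (right_mem_Icc.2 h) h
  simp only [P, posPart_F_self, posPart_G_self] at this ⊢
  linarith

lemma posPart_F_pos {c s : ℝ} (h : c < s) : 0 < (posPart c).F s := by
  have e : (posPart c).F s = 0 + ∫ x in c..s, (posPart c).f x := rfl
  rw [e, zero_add]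
  refine intervalIntegral.intervalIntegral_pos_of_pos_on
    ((posPart c).lipschitz_f.continuous.intervalIntegrable _ _) (fun x hx => ?_) h
  rw [posPart_f]
  exact lt_min (lt_max_of_lt_left (by linarith [hx.1])) one_pos

lemma posPart_G_pos {c s : ℝ} (h : c < s) : 0 < (posPart c).G s := by
  have h1 := pow_pos (posPart_F_pos h) 2
  have h2 := posPart_F_sq_le c s
  have h3 := (posPart c).f_nonneg s
  by_contra hle
  nlinarith [mul_nonneg h3 (sub_nonneg.2 (not_lt.1 hle))]

lemma posPart_G_nonneg (c s : ℝ) : 0 ≤ (posPart c).G s := by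
  rcases le_or_gt s c with h | h
  · rw [posPart_G_of_le h]
  · exact (posPart_G_pos h).le

end ConvexProfile

lemma IsWeakSolution.continuousOn_energy {a : ℝ → Hdot1} {y₀ : ℝ → ℝ} {y : ℝ → L2}
    (hy : IsWeakSolution a y₀ y) (P : ConvexProfile) :
    ContinuousOn (fun t => P.energy (y t)) (Ici 0) :=
  P.continuous_energy.comp_continuousOn hy.1

/-- The weak maximum principle: an upper bound at one time persists. -/
lemma IsWeakSolution.le_of_le {a : ℝ → Hdot1} {M : ℝ}
    (haM : ∀ τ : ℝ, 0 ≤ τ → ‖a τ‖ ≤ M) {y₀ : ℝ → ℝ} {y : ℝ → L2}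
    (hy : IsWeakSolution a y₀ y) {c s t : ℝ} (hs : 0 ≤ s) (hst : s < t)
    (h : ∀ᵐ x ∂unitMeasure, y s x ≤ c) : ∀ᵐ x ∂unitMeasure, y t x ≤ c := by
  obtain ⟨Y, hYy, hen⟩ := hy.energy_inequality haM
  set P := ConvexProfile.posPart c
  set E : ℝ → ℝ := fun t => P.energy (y t) with hE
  have hEc : ContinuousOn E (Ici 0) := hy.continuousOn_energy P
  have hEs : E s = 0 := by
    refine integral_eq_zero_of_ae ?_
    filter_upwards [h] with x hx
    exact ConvexProfile.posPart_G_of_le hx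
  have hEi : ∀ p q : ℝ, 0 < p → IntegrableOn E (Icc p q) := fun p q hp =>
    (hEc.mono fun x hx => hp.le.trans hx.1).integrableOn_compact isCompact_Icc
  -- absorption of the drift by Young's inequality
  have hineq : ∀ p q : ℝ, 0 < p → p < q → E q - E p ≤ ∫ τ in Icc p q, M ^ 2 / 2 * E τ := by
    intro p q hp hpq
    refine hen P p q _ hp hpq ((hEi p q hp).const_mul _) ?_
    have hsub : Icc p q ⊆ Ioi 0 := fun t ht => hp.trans_le ht.1
    filter_upwards [ae_mono (Measure.restrict_mono_set volume hsub) hYy] with τ hτ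
    have hEτ : E τ = ∫ x, P.G (H1per.fn (Y τ) x) ∂unitMeasure := by
      simp only [hE, ← hτ]; rfl
    rw [hEτ, ← integral_const_mul]
    refine integral_mono ((P.integrable_f_comp_mul_sq _ _).neg.add
      ((P.integrable_abs_F_comp_mul _ _).const_mul M))
      ((P.integrable_G_comp _).const_mul _) fun x => ?_
    set u := H1per.fn (Y τ) x
    set v := H1per.dx (Y τ) x
    have h1 : P.F u ^ 2 ≤ 2 * P.f u * P.G u := ConvexProfile.posPart_F_sq_le c u
    have h2 := P.f_nonneg u
    have h3 : 0 ≤ P.G u := ConvexProfile.posPart_G_nonneg c u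
    have h4 : M * |P.F u * v| ≤ P.f u * v ^ 2 + M ^ 2 / 2 * P.G u := by
      have h5 : (M * |P.F u * v|) ^ 2 ≤ (P.f u * v ^ 2 + M ^ 2 / 2 * P.G u) ^ 2 := by
        rw [mul_pow, sq_abs, mul_pow]
        nlinarith [sq_nonneg (P.f u * v ^ 2 - M ^ 2 / 2 * P.G u),
          mul_le_mul_of_nonneg_left h1 (by positivity : 0 ≤ M ^ 2 * v ^ 2)]
      exact (abs_le_of_sq_le_sq' h5 (by positivity)).2
    linarith
  have hgron : ∀ r ∈ Ioo s t, E t ≤ E r * Real.exp (M ^ 2 / 2 * (t - r)) := by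
    intro r hr
    have hr0 : 0 < r := hs.trans_lt hr.1
    have := le_gronwallBound_of_liminf_deriv_right_le (f := E) (f' := fun x => M ^ 2 / 2 * E x)
      (δ := E r) (K := M ^ 2 / 2) (ε := 0) (a := r) (b := t)
      (hEc.mono fun x hx => hr0.le.trans hx.1) ?_ le_rfl (fun x _ => by simp) t
      (right_mem_Icc.2 hr.2.le)
    · rwa [gronwallBound_ε0] at this
    intro x hx ρ hρ
    have hx0 : 0 < x := hr0.trans_le hx.1
    have hd : HasDerivAt (fun z => ∫ τ in x..z, M ^ 2 / 2 * E τ) (M ^ 2 / 2 * E x) x := by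
      have hEc' : ContinuousOn (fun τ => M ^ 2 / 2 * E τ) (Ioi 0) :=
        (hEc.mono Ioi_subset_Ici_self).const_mul _
      exact intervalIntegral.integral_hasDerivAt_right (by simp)
        (hEc'.stronglyMeasurableAtFilter isOpen_Ioi x hx0) (hEc'.continuousAt (Ioi_mem_nhds hx0))
    have hlim := (hasDerivWithinAt_iff_tendsto_slope' (s := Ioi x) (by simp)).1
      hd.hasDerivWithinAt
    refine Filter.Eventually.frequently ?_
    filter_upwards [hlim.eventually_lt_const hρ, self_mem_nhdsWithin] with z hz hxz
    refine lt_of_le_of_lt ?_ hz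
    have hxz' : x < z := hxz
    have := hineq x z hx0 hxz'
    rw [slope_def_field, intervalIntegral.integral_same, sub_zero, div_eq_inv_mul,
      intervalIntegral.integral_of_le hxz'.le, ← integral_Icc_eq_integral_Ioc]
    exact mul_le_mul_of_nonneg_left this (inv_nonneg.2 (by linarith))
  -- `r → s`, where the energy vanishes
  have hEt : E t ≤ 0 := by
    have hlim : Filter.Tendsto (fun r => E r * Real.exp (M ^ 2 / 2 * (t - r)))
        (nhdsWithin s (Ioi s)) (nhds (E s * Real.exp (M ^ 2 / 2 * (t - s)))) := by
      refine Filter.Tendsto.mul ((hEc s hs).mono_left (nhdsWithin_mono _ fun x hx =>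
        hs.trans (le_of_lt hx))) ?_
      have : Continuous fun r => Real.exp (M ^ 2 / 2 * (t - r)) := by fun_prop
      exact this.continuousWithinAt
    rw [hEs, zero_mul] at hlim
    refine ge_of_tendsto hlim ?_
    filter_upwards [Ioo_mem_nhdsGT hst] with r hr using hgron r hr
  have hG0 : 0 ≤ᵐ[unitMeasure] fun x => P.G (y t x) :=
    Filter.Eventually.of_forall fun x => ConvexProfile.posPart_G_nonneg c _
  have hzero := (integral_eq_zero_iff_of_nonneg_ae hG0 (P.integrable_G_comp (y t))).1
    (le_antisymm hEt (integral_nonneg_of_ae hG0))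
  filter_upwards [hzero] with x hx
  by_contra hlt
  exact (ConvexProfile.posPart_G_pos (not_le.1 hlt)).ne' hx

/-! ### Logarithmic profiles -/

namespace ConvexProfile

/-- The function `1 / (K - s + ε)`, extended to `s > K` by its value at `K`. -/
noncomputable def recip (K ε s : ℝ) : ℝ := (max (K - s) 0 + ε)⁻¹

lemma recip_of_le {K ε s : ℝ} (h : s ≤ K) : recip K ε s = (K - s + ε)⁻¹ := by
  rw [recip, max_eq_left (by linarith)]

variable {ε : ℝ} (hε : 0 < ε) (K : ℝ)
include hε

lemma recip_pos (s : ℝ) : 0 < recip K ε s := by unfold recip; positivity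

lemma recip_le (s : ℝ) : recip K ε s ≤ ε⁻¹ := by
  unfold recip
  gcongr
  simp

lemma abs_recip_sub_le (s t : ℝ) : |recip K ε s - recip K ε t| ≤ ε⁻¹ ^ 2 * |s - t| := by
  have hA : 0 < max (K - s) 0 + ε := by positivity
  have hB : 0 < max (K - t) 0 + ε := by positivity
  have e : recip K ε s - recip K ε t
      = (max (K - t) 0 - max (K - s) 0) * (recip K ε s * recip K ε t) := by
    unfold recip; field_simp; ring
  have h1 : |max (K - t) 0 - max (K - s) 0| ≤ |s - t| := by
    refine (abs_max_sub_max_le_abs _ _ _).trans (le_of_eq ?_)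
    congr 1; ring
  have h2 : recip K ε s * recip K ε t ≤ ε⁻¹ ^ 2 := by
    rw [sq]
    exact mul_le_mul (recip_le hε K s) (recip_le hε K t) (recip_pos hε K t).le (by positivity)
  have h3 := mul_pos (recip_pos hε K s) (recip_pos hε K t)
  rw [e, abs_mul, abs_of_pos h3, mul_comm]
  exact mul_le_mul h2 h1 (abs_nonneg _) (by positivity)

lemma lipschitz_recip : LipschitzWith (Real.toNNReal (ε⁻¹ ^ 2)) (recip K ε) :=
  LipschitzWith.of_dist_le_mul fun s t => by
    rw [Real.dist_eq, Real.dist_eq, Real.coe_toNNReal _ (by positivity)]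
    exact abs_recip_sub_le hε K s t

lemma lipschitz_recip_sq :
    LipschitzWith (Real.toNNReal (2 * ε⁻¹ * ε⁻¹ ^ 2)) fun s => recip K ε s ^ 2 :=
  LipschitzWith.of_dist_le_mul fun s t => by
    rw [Real.dist_eq, Real.dist_eq, Real.coe_toNNReal _ (by positivity), sq_sub_sq, abs_mul,
      mul_assoc]
    have h1 := recip_pos hε K s
    have h2 := recip_pos hε K t
    refine mul_le_mul ?_ (abs_recip_sub_le hε K s t) (abs_nonneg _) (by positivity)
    rw [abs_of_pos (by linarith)]
    linarith [recip_le hε K s, recip_le hε K t]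

/-- A profile with `F(s) = -log (K - s + ε)` for `s ≤ K`. -/
noncomputable def logFirst : ConvexProfile :=
  ofSecondDeriv (recip K ε) (Real.toNNReal ε⁻¹) (Real.toNNReal (ε⁻¹ ^ 2))
    (fun s => (recip_pos hε K s).le)
    (fun s => by rw [Real.coe_toNNReal _ (by positivity)]; exact recip_le hε K s)
    (lipschitz_recip hε K) K (-Real.log ε) 0

/-- A profile with `G(s) = -log (K - s + ε)` for `s ≤ K`. -/
noncomputable def logZeroth : ConvexProfile :=
  ofSecondDeriv (fun s => recip K ε s ^ 2) (Real.toNNReal (ε⁻¹ ^ 2))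
    (Real.toNNReal (2 * ε⁻¹ * ε⁻¹ ^ 2)) (fun s => by positivity)
    (fun s => by
      rw [Real.coe_toNNReal _ (by positivity)]
      exact pow_le_pow_left₀ (recip_pos hε K s).le (recip_le hε K s) 2)
    (lipschitz_recip_sq hε K) K ε⁻¹ (-Real.log ε)

lemma integral_recip {s : ℝ} (h : s ≤ K) :
    -Real.log ε + ∫ x in K..s, recip K ε x = -Real.log (K - s + ε) := by
  rw [intervalIntegral.integral_eq_sub_of_hasDerivAt
    (f := fun x => -Real.log (K - x + ε)) (fun x hx => ?_)
    ((lipschitz_recip hε K).continuous.intervalIntegrable _ _)]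
  · simp
  · rw [uIcc_of_ge h] at hx
    have hpos : 0 < K - x + ε := by linarith [hx.2]
    have := ((((hasDerivAt_id x).const_sub K).add_const ε).log hpos.ne').neg
    convert! this using 1
    rw [recip_of_le hx.2]
    simp [neg_div]

lemma logFirst_F {s : ℝ} (h : s ≤ K) : (logFirst hε K).F s = -Real.log (K - s + ε) :=
  integral_recip hε K h

lemma logZeroth_F {s : ℝ} (h : s ≤ K) : (logZeroth hε K).F s = recip K ε s := by
  have e : (logZeroth hε K).F s = ε⁻¹ + ∫ x in K..s, recip K ε x ^ 2 := rfl
  rw [e, recip_of_le h, intervalIntegral.integral_eq_sub_of_hasDerivAt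
    (f := fun x => (K - x + ε)⁻¹) (fun x hx => ?_)
    ((lipschitz_recip_sq hε K).continuous.intervalIntegrable _ _)]
  · simp
  · rw [uIcc_of_ge h] at hx
    have hpos : 0 < K - x + ε := by linarith [hx.2]
    have := (((hasDerivAt_id x).const_sub K).add_const ε).inv hpos.ne'
    convert! this using 1
    rw [recip_of_le hx.2]
    simp

lemma logZeroth_G {s : ℝ} (h : s ≤ K) : (logZeroth hε K).G s = -Real.log (K - s + ε) := by
  rw [← integral_recip hε K h]
  have e : (logZeroth hε K).G s = -Real.log ε + ∫ x in K..s, (logZeroth hε K).F x := rfl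
  rw [e]
  congr 1
  refine intervalIntegral.integral_congr fun x hx => ?_
  rw [uIcc_of_ge h] at hx
  exact logZeroth_F hε K hx.2

end ConvexProfile

/-! ### The strict maximum principle -/

lemma ae_ae_abs_sub_le (u : H1per) :
    ∀ᵐ x ∂unitMeasure, ∀ᵐ x' ∂unitMeasure,
      |H1per.fn u x - H1per.fn u x'| ≤ ‖H1per.dx u‖ := by
  obtain ⟨U, -, -, hU, -, hosc⟩ := exists_absolutelyContinuous_rep u
  filter_upwards [hU, ae_restrict_mem measurableSet_Ioo] with x hx hxI
  filter_upwards [hU, ae_restrict_mem measurableSet_Ioo] with x' hx' hxI'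
  rw [hx, hx']
  exact hosc x (Ioo_subset_Icc_self hxI) x' (Ioo_subset_Icc_self hxI')

lemma L2.norm_sq_eq_integral (u : L2) : ‖u‖ ^ 2 = ∫ x, u x ^ 2 ∂unitMeasure := by
  rw [← real_inner_self_eq_norm_sq, ← integral_mul_eq_inner]
  simp only [sq]

/-- If the mean of `K - u` is at least `m` and `log (K - u + ε)` has a derivative of norm at most
`ℓ`, then `K - u` is bounded below. -/
lemma le_sub_of_norm_dx_log_le {K ε m ℓ : ℝ} (hε : 0 < ε) (hm : 0 < m) (u : H1per)
    (hK : ∀ᵐ x ∂unitMeasure, H1per.fn u x ≤ K)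
    (hmean : m ≤ ∫ x, (K - H1per.fn u x) ∂unitMeasure)
    (hℓ : ∫ x, (ConvexProfile.recip K ε (H1per.fn u x) * H1per.dx u x) ^ 2 ∂unitMeasure ≤ ℓ ^ 2)
    (hℓ0 : 0 ≤ ℓ) (hεm : m * Real.exp (-ℓ) = 2 * ε) :
    ∀ᵐ x ∂unitMeasure, H1per.fn u x ≤ K - ε := by
  set Q := ConvexProfile.logFirst hε K
  have hnorm : ‖H1per.dx (Q.superpositionH1 u)‖ ≤ ℓ := by
    refine (abs_le_of_sq_le_sq' (le_trans (le_of_eq ?_) hℓ) hℓ0).2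
    rw [L2.norm_sq_eq_integral]
    refine integral_congr_ae ?_
    filter_upwards [Q.coeFn_weighted (H1per.fn u) (H1per.dx u)] with x hx
    rw [Q.dx_superpositionH1, hx]
    rfl
  have hfreq : ∃ᶠ x in ae unitMeasure, m ≤ K - H1per.fn u x := by
    intro hcon
    have hi : Integrable (fun x => K - H1per.fn u x) unitMeasure :=
      (integrable_const K).sub (L2.integrable _)
    have hpos : 0 ≤ᵐ[unitMeasure] fun x => m - (K - H1per.fn u x) :=
      hcon.mono fun x hx => by simp only [Pi.zero_apply]; linarith [not_le.1 hx]
    have hint : ∫ x, (m - (K - H1per.fn u x)) ∂unitMeasure = 0 := by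
      refine le_antisymm ?_ (integral_nonneg_of_ae hpos)
      rw [integral_sub (integrable_const m) hi]
      simpa using hmean
    have h0 := (integral_eq_zero_iff_of_nonneg_ae hpos ((integrable_const m).sub hi)).1 hint
    obtain ⟨x, hx, hx'⟩ := (hcon.and h0).exists
    exact hx (by simp only [Pi.zero_apply] at hx'; linarith)
  have hfn := Q.coeFn_superposition (H1per.fn u)
  filter_upwards [ae_ae_abs_sub_le (Q.superpositionH1 u), hfn, hK] with x hx hxF hxK
  obtain ⟨x', hx'm, hx'osc, hx'F, hx'K⟩ := (hfreq.and_eventually (hx.and (hfn.and hK))).exists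
  rw [Q.fn_superpositionH1, hxF, hx'F, ConvexProfile.logFirst_F hε K hxK,
    ConvexProfile.logFirst_F hε K hx'K] at hx'osc
  have h1 := (le_abs_self _).trans (hx'osc.trans hnorm)
  have h2 : Real.log m ≤ Real.log (K - H1per.fn u x' + ε) := Real.log_le_log hm (by linarith)
  have h3 : Real.log (m * Real.exp (-ℓ)) ≤ Real.log (K - H1per.fn u x + ε) := by
    rw [Real.log_mul hm.ne' (Real.exp_ne_zero _), Real.log_exp]
    linarith
  rw [Real.log_le_log_iff (by positivity) (by linarith), hεm] at h3
  linarith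

lemma continuous_integral_const_sub (K : ℝ) :
    Continuous fun u : L2 => ∫ x, (K - u x) ∂unitMeasure := by
  -- the integral is the inner product with the constant function `1`
  have e : (fun u : L2 => ∫ x, (K - u x) ∂unitMeasure)
      = fun u : L2 => K - inner ℝ u ((memLp_const (1 : ℝ)).toLp (μ := unitMeasure) (p := 2)) := by
    ext u
    rw [integral_sub (integrable_const K) (L2.integrable u), ← integral_mul_eq_inner]
    congr 1
    · simp
    · refine integral_congr_ae ?_
      filter_upwards [(memLp_const (1 : ℝ) (μ := unitMeasure) (p := 2)).coeFn_toLp] with x hx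
      rw [hx, mul_one]
  rw [e]
  fun_prop

/-- The strict one-sided maximum principle. For small `ε` the energy inequality for
`G(s) = -log (K - s + ε)` yields a time at which `K - y ≥ ε`, and the weak maximum principle
propagates the bound `y ≤ K - ε` to all later times. -/
lemma IsWeakSolution.exists_le_sub {a : ℝ → Hdot1} {M : ℝ}
    (haM : ∀ τ : ℝ, 0 ≤ τ → ‖a τ‖ ≤ M) {y₀ : ℝ → ℝ} {y : ℝ → L2}
    (hy : IsWeakSolution a y₀ y) {K : ℝ} (hK : ∀ᵐ x ∂unitMeasure, y₀ x ≤ K)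
    (hconst : ¬ ∃ c : ℝ, ∀ᵐ x ∂unitMeasure, y₀ x = c) {τ : ℝ} (hτ : 0 < τ) :
    ∃ δ : ℝ, 0 < δ ∧ ∀ᵐ x ∂unitMeasure, y τ x ≤ K - δ := by
  have hy0 := hy.2.1
  have hK0 : ∀ᵐ x ∂unitMeasure, y 0 x ≤ K := by
    filter_upwards [hy0, hK] with x h1 h2
    rw [h1]; exact h2
  have hKt : ∀ t, 0 < t → ∀ᵐ x ∂unitMeasure, y t x ≤ K := fun t ht =>
    hy.le_of_le haM le_rfl ht hK0
  have hint : ∀ t, Integrable (fun x => K - y t x) unitMeasure := fun t =>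
    (integrable_const K).sub (L2.integrable _)
  -- the mean of `K - y` is positive at the initial time
  set d : ℝ → ℝ := fun t => ∫ x, (K - y t x) ∂unitMeasure
  have hd0 : 0 < d 0 := by
    have hnn : 0 ≤ᵐ[unitMeasure] fun x => K - y 0 x := hK0.mono fun x hx => sub_nonneg.2 hx
    refine lt_of_le_of_ne (integral_nonneg_of_ae hnn) fun h => hconst ⟨K, ?_⟩
    filter_upwards [(integral_eq_zero_iff_of_nonneg_ae hnn (hint 0)).1 h.symm, hy0] with x h1 h2
    rw [← h2]
    simp only [Pi.zero_apply] at h1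
    linarith
  have hdc : ContinuousOn d (Ici 0) := (continuous_integral_const_sub K).comp_continuousOn hy.1
  set m := d 0 / 2 with hm
  have hm0 : 0 < m := by positivity
  obtain ⟨t₀, ht₀, ht₀τ, hdt⟩ : ∃ t₀, 0 < t₀ ∧ t₀ < τ ∧ ∀ t ∈ Icc 0 t₀, m ≤ d t ∧ d t ≤ 4 * m := by
    have h1 : ∀ᶠ t in nhdsWithin 0 (Ici 0), d t ∈ Ioo m (4 * m) :=
      (hdc 0 self_mem_Ici).eventually (Ioo_mem_nhds (by linarith) (by linarith))
    obtain ⟨u, hu, hsub⟩ := (mem_nhdsGE_iff_exists_Ico_subset).1 h1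
    have hu0 : 0 < u := hu
    refine ⟨min u τ / 2, by positivity, ?_, fun t ht => ?_⟩
    · linarith [min_le_right u τ]
    · have := hsub ⟨ht.1, by linarith [ht.2, min_le_left u τ, lt_min hu0 hτ]⟩
      exact ⟨this.1.le, this.2.le⟩
  -- the choice of `ℓ`: the logarithmic energy gained is linear in `ℓ`, the dissipation quadratic
  obtain ⟨ℓ, hℓ1, hℓ⟩ : ∃ ℓ : ℝ, 1 ≤ ℓ ∧
      ℓ + (Real.log 2 - Real.log m + 5 * m) < t₀ / 4 * (ℓ ^ 2 - M ^ 2) := by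
    set A := |Real.log 2 - Real.log m + 5 * m| + t₀ / 4 * M ^ 2
    have hA : 0 ≤ A := by positivity
    refine ⟨1 + (A + 2) * (4 / t₀), by
      have : 0 ≤ (A + 2) * (4 / t₀) := by positivity
      linarith, ?_⟩
    set ℓ := 1 + (A + 2) * (4 / t₀)
    have h1 : t₀ / 4 * ℓ = t₀ / 4 + (A + 2) := by simp only [ℓ]; field_simp
    have h2 : 1 ≤ ℓ := by
      have : 0 ≤ (A + 2) * (4 / t₀) := by positivity
      simp only [ℓ]; linarith
    have h3 : t₀ / 4 * ℓ ^ 2 = (t₀ / 4 + (A + 2)) * ℓ := by rw [← h1]; ring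
    have h4 := le_abs_self (Real.log 2 - Real.log m + 5 * m)
    have h5 : (A + 2) * ℓ ≤ (t₀ / 4 + (A + 2)) * ℓ := by
      refine mul_le_mul_of_nonneg_right (by linarith) (by linarith)
    have h6 : A + 1 + ℓ ≤ (A + 2) * ℓ := by nlinarith
    simp only [A] at h3 h5 h6 ⊢
    linarith
  set ε := m * Real.exp (-ℓ) / 2 with hεdef
  have hε : 0 < ε := by positivity
  have hεm : m * Real.exp (-ℓ) = 2 * ε := by rw [hεdef]; ring
  have hεle : ε ≤ m := by
    have : Real.exp (-ℓ) ≤ 1 := Real.exp_le_one_iff.2 (by linarith)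
    have := mul_le_mul_of_nonneg_left this hm0.le
    linarith
  have hlogε : Real.log ε = Real.log m - ℓ - Real.log 2 := by
    rw [hεdef, Real.log_div (by positivity) two_ne_zero,
      Real.log_mul hm0.ne' (Real.exp_ne_zero _), Real.log_exp]
    ring
  set P := ConvexProfile.logZeroth hε K
  obtain ⟨Y, hYy, hen⟩ := hy.energy_inequality haM
  have hsub : Icc (t₀ / 2) t₀ ⊆ Ioi 0 := fun t ht => lt_of_lt_of_le (by positivity) ht.1
  have hYy' := ae_mono (Measure.restrict_mono_set volume hsub) hYy
  -- at some time in `[t₀ / 2, t₀]` the dissipation is at most `ℓ ^ 2`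
  have hgood : ∃ t ∈ Icc (t₀ / 2) t₀, H1per.fn (Y t) = y t ∧
      ∫ x, (ConvexProfile.recip K ε (H1per.fn (Y t) x) * H1per.dx (Y t) x) ^ 2 ∂unitMeasure
        ≤ ℓ ^ 2 := by
    by_contra! hcon
    have hup := hen P (t₀ / 2) t₀ (fun _ => (M ^ 2 - ℓ ^ 2) / 2) (by positivity) (by linarith)
      (integrableOn_const (by simp)) (by
        filter_upwards [hYy', ae_restrict_mem measurableSet_Icc] with t ht htI
        have hlow := hcon t htI ht
        set u := H1per.fn (Y t)
        set v := H1per.dx (Y t)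
        have huK : ∀ᵐ x ∂unitMeasure, u x ≤ K := by rw [ht]; exact hKt t (hsub htI)
        have hsq : Integrable (fun x => (ConvexProfile.recip K ε (u x) * v x) ^ 2) unitMeasure := by
          refine (P.integrable_f_comp_mul_sq u v).congr
            (Filter.Eventually.of_forall fun x => ?_)
          simp only [mul_pow]; rfl
        have hle : ∫ x, (-(P.f (u x) * v x ^ 2) + M * |P.F (u x) * v x|) ∂unitMeasure
            ≤ ∫ x, (M ^ 2 / 2 - (ConvexProfile.recip K ε (u x) * v x) ^ 2 / 2) ∂unitMeasure := by
          refine integral_mono_ae ((P.integrable_f_comp_mul_sq u v).neg.add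
            ((P.integrable_abs_F_comp_mul u v).const_mul M))
            ((integrable_const _).sub (hsq.div_const 2)) ?_
          filter_upwards [huK] with x hx
          have e1 : P.f (u x) * v x ^ 2 = (ConvexProfile.recip K ε (u x) * v x) ^ 2 := by
            rw [mul_pow]; rfl
          rw [e1, ConvexProfile.logZeroth_F hε K hx]
          rw [← sq_abs (ConvexProfile.recip K ε (u x) * v x)]
          nlinarith [sq_nonneg (M - |ConvexProfile.recip K ε (u x) * v x|)]
        refine hle.trans ?_
        rw [integral_sub (integrable_const _) (hsq.div_const 2),
          integral_div 2 fun x => (ConvexProfile.recip K ε (u x) * v x) ^ 2]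
        simp only [integral_const, probReal_univ, one_smul]
        linarith)
    rw [setIntegral_const, Real.volume_real_Icc_of_le (by linarith), smul_eq_mul] at hup
    have hEs : P.energy (y (t₀ / 2)) ≤ -Real.log ε := by
      have h1 : ∫ x, P.G (y (t₀ / 2) x) ∂unitMeasure ≤ ∫ _, -Real.log ε ∂unitMeasure := by
        refine integral_mono_ae (P.integrable_G_comp _) (integrable_const _) ?_
        filter_upwards [hKt (t₀ / 2) (by positivity)] with x hx
        rw [ConvexProfile.logZeroth_G hε K hx]
        exact neg_le_neg (Real.log_le_log hε (by linarith))
      exact h1.trans (by simp)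
    -- a lower bound by the mean, from `log x ≤ x - 1`
    have hET : -(5 * m) ≤ P.energy (y t₀) := by
      have h1 : ∫ x, -((K - y t₀ x) + ε) ∂unitMeasure ≤ ∫ x, P.G (y t₀ x) ∂unitMeasure := by
        refine integral_mono_ae ((hint t₀).add (integrable_const ε)).neg
          (P.integrable_G_comp _) ?_
        filter_upwards [hKt t₀ ht₀] with x hx
        rw [ConvexProfile.logZeroth_G hε K hx]
        have := Real.log_le_sub_one_of_pos (show 0 < K - y t₀ x + ε by linarith)
        linarith
      rw [integral_neg, integral_add (hint t₀) (integrable_const ε)] at h1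
      simp only [integral_const, probReal_univ, one_smul] at h1
      have h2 := (hdt t₀ ⟨ht₀.le, le_rfl⟩).2
      simp only [d] at h2
      refine le_trans ?_ h1
      linarith
    nlinarith
  obtain ⟨t, htI, hYt, hdiss⟩ := hgood
  have ht0 : 0 < t := hsub htI
  have hyt : ∀ᵐ x ∂unitMeasure, y t x ≤ K - ε := by
    rw [← hYt]
    refine le_sub_of_norm_dx_log_le hε hm0 (Y t) ?_ ?_ hdiss (by linarith) hεm
    · rw [hYt]; exact hKt t ht0
    · rw [hYt]; exact (hdt t ⟨ht0.le, htI.2⟩).1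
  exact ⟨ε, hε, hy.le_of_le haM ht0.le (htI.2.trans_lt ht₀τ) hyt⟩

lemma IsWeakSolution.neg {a : ℝ → Hdot1} {y₀ : ℝ → ℝ} {y : ℝ → L2}
    (hy : IsWeakSolution a y₀ y) : IsWeakSolution a (fun x => -y₀ x) (fun τ => -y τ) := by
  obtain ⟨hyc, hy0, Y, yτ, hY, hYy, hyτ, hw, heq⟩ := hy
  refine ⟨hyc.neg, ?_, fun τ => -Y τ, fun τ => -yτ τ, fun s T h1 h2 => (hY s T h1 h2).neg, ?_,
    fun s T h1 h2 => (hyτ s T h1 h2).neg, ?_, fun z => ?_⟩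
  · filter_upwards [hy0, Lp.coeFn_neg (y 0)] with x h1 h2
    rw [h2, Pi.neg_apply, h1]
  · filter_upwards [hYy] with τ h
    rw [map_neg, h]
  · intro φ h1 h2 h3
    have h4 := hw φ h1 h2 h3
    have e : ∀ v : L2, toH1perDual (-v) = -toH1perDual v := fun v => by
      simp [toH1perDual]
    simp only [e, smul_neg, integral_neg, h4]
  · filter_upwards [heq z] with τ h
    rw [integral_mul_eq_inner, Hdot1.integral_mul_mul_eq_inner] at h ⊢
    have e : ((a τ).memLp_mul (H1per.dx (-Y τ))).toLp
        = -((a τ).memLp_mul (H1per.dx (Y τ))).toLp := by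
      rw [map_neg]
      refine Lp.ext ?_
      filter_upwards [((a τ).memLp_mul (-H1per.dx (Y τ))).coeFn_toLp,
        ((a τ).memLp_mul (H1per.dx (Y τ))).coeFn_toLp, Lp.coeFn_neg (H1per.dx (Y τ)),
        Lp.coeFn_neg ((a τ).memLp_mul (H1per.dx (Y τ))).toLp] with x h1 h2 h3 h4
      rw [h1, h4, Pi.neg_apply, h2, h3, Pi.neg_apply, mul_neg]
    rw [e, map_neg, inner_neg_left, inner_neg_left]
    change -(yτ τ z) + _ - _ = 0
    linarith

end PeriodicParabolic

theorem mainTheorem5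
    (a : ℝ → PeriodicParabolic.Hdot1) (M : ℝ)
    (ha : ContinuousOn a (Ici 0))
    (haM : ∀ τ : ℝ, 0 ≤ τ → ‖a τ‖ ≤ M)
    (haτ : ∃ aτ : ℝ → PeriodicParabolic.L2, PeriodicParabolic.MemL2loc aτ ∧
      PeriodicParabolic.IsWeakTimeDeriv (fun τ => PeriodicParabolic.Hdot1.fn (a τ)) aτ)
    (y₀ : ℝ → ℝ) (hy₀ : MemLp y₀ ∞ PeriodicParabolic.unitMeasure)
    (hconst : ¬ ∃ c : ℝ, ∀ᵐ x ∂PeriodicParabolic.unitMeasure, y₀ x = c)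
    (y : ℝ → PeriodicParabolic.L2) (hy : PeriodicParabolic.IsWeakSolution a y₀ y) :
    ∀ τ : ℝ, 0 < τ →
      eLpNorm (y τ) ∞ PeriodicParabolic.unitMeasure
        < eLpNorm y₀ ∞ PeriodicParabolic.unitMeasure := by
  intro τ hτ
  set K := (eLpNorm y₀ ∞ PeriodicParabolic.unitMeasure).toReal
  have hKe : eLpNorm y₀ ∞ PeriodicParabolic.unitMeasure = ENNReal.ofReal K :=
    (ENNReal.ofReal_toReal hy₀.2.ne).symm
  have hK0 : 0 ≤ K := ENNReal.toReal_nonneg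
  have habs : ∀ᵐ x ∂PeriodicParabolic.unitMeasure, |y₀ x| ≤ K := by
    filter_upwards [ae_le_eLpNormEssSup (f := y₀) (μ := PeriodicParabolic.unitMeasure)] with x hx
    rw [← eLpNorm_exponent_top, hKe, Real.enorm_eq_ofReal_abs,
      ENNReal.ofReal_le_ofReal_iff hK0] at hx
    exact hx
  have hKpos : 0 < K := by
    refine lt_of_le_of_ne hK0 fun h => hconst ⟨0, ?_⟩
    filter_upwards [habs] with x hx
    rw [← h] at hx
    exact abs_nonpos_iff.1 hx
  obtain ⟨δ₁, hδ₁, h1⟩ := hy.exists_le_sub haM (habs.mono fun x hx => (abs_le.1 hx).2) hconst hτ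
  -- the lower bound is the upper bound for the solution `-y`
  obtain ⟨δ₂, hδ₂, h2⟩ := hy.neg.exists_le_sub haM (K := K)
    (habs.mono fun x hx => by linarith [(abs_le.1 hx).1])
    (fun ⟨c, hc⟩ => hconst ⟨-c, hc.mono fun x hx => by linarith⟩) hτ
  have hbound : ∀ᵐ x ∂PeriodicParabolic.unitMeasure, ‖y τ x‖ ≤ K - min δ₁ δ₂ := by
    filter_upwards [h1, h2, Lp.coeFn_neg (y τ)] with x h3 h4 h5
    rw [h5, Pi.neg_apply] at h4
    rw [Real.norm_eq_abs, abs_le]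
    constructor <;> linarith [min_le_left δ₁ δ₂, min_le_right δ₁ δ₂]
  rw [hKe, eLpNorm_exponent_top]
  exact (eLpNormEssSup_le_of_ae_bound hbound).trans_lt
    ((ENNReal.ofReal_lt_ofReal_iff hKpos).2 (by linarith [lt_min hδ₁ hδ₂]))
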